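/- **Setting.** Let $(\Omega,\mathcal F,\mathbb P)$ be an atomless probability space. Let $\mathcal H$ be the set of functions $h:[0,1]\to\mathbb R$ of bounded variation with $h(0)=0$ (not necessarily monotone, concave or continuous). For $h\in\mathcal H$ and a distribution $F$ on $\mathbb R$ with finite mean put, with $S_F(x)=1-F(x)$, $$\rho_h(F)=\int_0^\infty h(S_F(x))\,dx+\int_{-\infty}^0\bigl(h(S_F(x))-h(1)\bigr)\,dx .$$ This is a number in $[-\infty,\infty]$, defined as the integral of the positive part minus the integral of the negative part of the integrands whenever these are not both infinite. Below, $\sup_{F\in\mathcal M}\rho_h(F)$ is the supremum in $[-\infty,\infty]$ over those $F\in\mathcal M$ for which $\rho_h(F)$ is defined. Let $h^*(t)=\inf\{g(t): g\in\mathcal H,\ g\ge h,\ g\text{ concave on }[0,1]\}$ be the concave envelope of $h$. Let $\hat h(t)=\max\{h(t^+),h(t^-),h(t)\}$ if $t\in(0,1)$ is a discontinuity point of $h$, and $\hat h(t)=h(t)$ otherwise (in particular at $t=0,1$). The set $\{t\in[0,1]:\hat h(t)\ne h^*(t)\}$ is a union of disjoint open intervals $(a,b)$; let $\mathcal I_h$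 be the collection of the intervals $(1-b,1-a)$, where $(a,b)$ runs through these maximal intervals. For $F$ with left-quantile function $F^{-1}$, $U$ uniform on $[0,1]$ and an interval $C\subset[0,1]$ (of positive length), the $C$-concentration $F^C$ is the law of $F^{-1}(U)1_{\{U\notin C\}}+\mathbb E[F^{-1}(U)\mid U\in C]\,1_{\{U\in C\}}$; for a collection $\mathcal I$ of disjoint intervals, $F^{\mathcal I}$ is the law of $F^{-1}(U)1_{\{U\notin\bigcup\mathcal I\}}+\sum_{C\in\mathcal I}\mathbb E[F^{-1}(U)\mid U\in C]\,1_{\{U\in C\}}$. A set $\mathcal M$ of distributions with finite mean is closed under concentration within $\mathcal I$ if $F^C\in\mathcal M$ for all $F\in\mathcal M$, $C\in\mathcal I$; it is closed under concentration if this holds for all intervals $C\subset[0,1]$; it is closed under conditional expectation if, whenever a random variable $X$ on $\Omega$ has its law in $\mathcal M$, the law of $\mathbb E[X\mid\mathcal G]$ is in $\mathcal M$ for every sub-$\sigma$-algebra $\mathcal G$ of $\mathcal F$. **Theorem.** Let $\mathcal M$ be a set of distributions on $\mathbb R$ with finite mean and $h\in\mathcal H$. (i) If $\mathcal M$ is closed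 under concentration, then $$\sup_{F\in\mathcal M}\rho_h(F)=\sup_{F\in\mathcal M}\rho_{h^*}(F).\qquad(*)$$ For (ii) and (iii) assume that $h=\hat h$ and that $h^*$ is continuous on the closure $[a,b]$ of each of the maximal open intervals $(a,b)$ of $\{\hat h\ne h^*\}$. (Since $h^*$ is continuous on $(0,1)$, this only concerns an interval that has $0$ or $1$ as an endpoint; it holds whenever $h$ is continuous at $0$ and $1$.) (ii) If $\mathcal M$ is closed under concentration within $\mathcal I_h$, and either $\mathcal I_h$ is finite or $\rho_h(F)$ is defined and $>-\infty$ for every $F\in\mathcal M$ (for instance, if $\rho_h$ is finite on $\mathcal M$), then $(*)$ holds. (iii) If $\mathcal M$ is closed under conditional expectation and the supremum $\sup_{G\in\mathcal M}\rho_{h^*}(G)$ is attained by some $F\in\mathcal M$, then $F^{\mathcal I_h}\in\mathcal M$, both $\rho_h$ and $\rho_{h^*}$ are defined at $F^{\mathcal I_h}$, and $F^{\mathcal I_h}$ attains both suprema in $(*)$. -/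

import Mathlib

open MeasureTheory Set

noncomputable section

namespace DistortionRisk

/-! ### Distortion functions and their envelopes

Distortion functions are functions on `[0,1]`; they are represented by functions `ℝ → ℝ` of which
only the values on `[0,1]` are ever used. -/

/-- A distortion function: bounded variation on `[0,1]` and `h 0 = 0`. -/
structure IsDistortion (h : ℝ → ℝ) : Prop where
  bv : BoundedVariationOn h (Icc 0 1)
  zero : h 0 = 0

/-- The concave envelope of `h`: the pointwise infimum of all concave distortion functions that
dominate `h` on `[0,1]`. -/
def concaveEnv (h : ℝ → ℝ) (t : ℝ) : ℝ :=
  sInf {y | ∃ g : ℝ → ℝ, IsDistortion g ∧ ConcaveOn ℝ (Icc 0 1) g ∧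
    (∀ s ∈ Icc (0 : ℝ) 1, h s ≤ g s) ∧ y = g t}

/-- The discontinuity points of `h` in the open interval `(0,1)`. -/
def jumpSet (h : ℝ → ℝ) : Set ℝ :=
  {t | t ∈ Ioo (0 : ℝ) 1 ∧ (h t ≠ Function.rightLim h t ∨ h t ≠ Function.leftLim h t)}

open Classical in
/-- The upper semicontinuous modification of `h`; nothing is changed at `0` and `1`. -/
def uscMod (h : ℝ → ℝ) (t : ℝ) : ℝ :=
  if t ∈ jumpSet h then max (max (Function.rightLim h t) (Function.leftLim h t)) (h t) else h t

/-- The points of `[0,1]` where the upper semicontinuous modification and the concave envelope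
differ. -/
def gapSet (h : ℝ → ℝ) : Set ℝ :=
  {t | t ∈ Icc (0 : ℝ) 1 ∧ uscMod h t ≠ concaveEnv h t}

/-- `(a, b)` is one of the (maximal) open intervals that make up `gapSet h`. -/
def IsGap (h : ℝ → ℝ) (a b : ℝ) : Prop :=
  a < b ∧ Ioo a b ⊆ gapSet h ∧ a ∉ gapSet h ∧ b ∉ gapSet h

/-- The collection of intervals `(1 - b, 1 - a)`, where `(a, b)` runs through the open intervals
that make up `gapSet h`. -/
def gapIntervals (h : ℝ → ℝ) : Set (Set ℝ) :=
  {C | ∃ a b : ℝ, IsGap h a b ∧ C = Ioo (1 - b) (1 - a)}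

/-! ### Distributions with finite mean -/

/-- The set of all distributions on `ℝ` with finite mean. -/
def finiteMean : Set (Measure ℝ) :=
  {μ | IsProbabilityMeasure μ ∧ Integrable (fun x : ℝ => x) μ}

/-- The left-quantile function of `μ`. -/
def quantile (μ : Measure ℝ) (u : ℝ) : ℝ :=
  sInf {x : ℝ | u ≤ μ.real (Iic x)}

/-- The uniform distribution on `[0,1]`. -/
def unif : Measure ℝ := volume.restrict (Icc 0 1)

/-! ### Distortion riskmetrics

The riskmetric `ρ_h` of a distribution is
`∫_{(0,∞)} h(μ(x,∞)) dx + ∫_{(-∞,0)} (h(μ(x,∞)) - h 1) dx`.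
It is defined as an extended real number, as the integral of the positive part minus the integral
of the negative part, whenever at least one of these is finite. -/

/-- The integral of the positive part of the integrands in `ρ_h`. -/
def rhoPos (h : ℝ → ℝ) (μ : Measure ℝ) : ENNReal :=
  (∫⁻ x in Ioi (0 : ℝ), ENNReal.ofReal (h (μ.real (Ioi x)))) +
    ∫⁻ x in Iio (0 : ℝ), ENNReal.ofReal (h (μ.real (Ioi x)) - h 1)

/-- The integral of the negative part of the integrands in `ρ_h`. -/
def rhoNeg (h : ℝ → ℝ) (μ : Measure ℝ) : ENNReal :=
  (∫⁻ x in Ioi (0 : ℝ), ENNReal.ofReal (-h (μ.real (Ioi x)))) +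
    ∫⁻ x in Iio (0 : ℝ), ENNReal.ofReal (-(h (μ.real (Ioi x)) - h 1))

/-- `ρ_h` is well defined at `μ`, with a value in `[-∞, ∞]`. -/
def RhoDefined (h : ℝ → ℝ) (μ : Measure ℝ) : Prop :=
  rhoPos h μ ≠ ⊤ ∨ rhoNeg h μ ≠ ⊤

/-- The distortion riskmetric `ρ_h` as a function of the distribution; meaningful where
`RhoDefined h μ` holds. -/
def rho (h : ℝ → ℝ) (μ : Measure ℝ) : EReal :=
  (rhoPos h μ : EReal) - (rhoNeg h μ : EReal)

/-- The supremum of `ρ_h` over those distributions in `M` for which it is well defined. -/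
def supRho (h : ℝ → ℝ) (M : Set (Measure ℝ)) : EReal :=
  sSup {r | ∃ μ ∈ M, RhoDefined h μ ∧ r = rho h μ}

/-! ### Concentration -/

open Classical in
/-- The `C`-concentration of `μ`, for an interval `C` in `[0,1]`: the law of
`q(U) 1_{U ∉ C} + E[q(U) | U ∈ C] 1_{U ∈ C}`, where `q` is the left-quantile function of `μ` and `U`
is uniform on `[0,1]`. -/
def conc (C : Set ℝ) (μ : Measure ℝ) : Measure ℝ :=
  Measure.map (fun u => if u ∈ C then ⨍ v in C, quantile μ v else quantile μ u) unif

open Classical in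
/-- The concentration of `μ` for a collection `𝓘` of disjoint intervals in `[0,1]`: the law of
`q(U) 1_{U ∉ ⋃ 𝓘} + ∑_{C ∈ 𝓘} E[q(U) | U ∈ C] 1_{U ∈ C}`. -/
def concAll (𝓘 : Set (Set ℝ)) (μ : Measure ℝ) : Measure ℝ :=
  Measure.map (fun u => (if u ∈ ⋃₀ 𝓘 then 0 else quantile μ u) +
    ∑ᶠ C ∈ 𝓘, C.indicator (fun _ => ⨍ v in C, quantile μ v) u) unif

/-- `M` is closed under concentration within the collection `𝓘`. -/
def ClosedConcWithin (𝓘 : Set (Set ℝ)) (M : Set (Measure ℝ)) : Prop :=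
  ∀ μ ∈ M, ∀ C ∈ 𝓘, conc C μ ∈ M

/-- `M` is closed under concentration: the collection consists of all intervals in `[0,1]`, of
any type. (Concentration on a null interval changes nothing.) -/
def ClosedConc (M : Set (Measure ℝ)) : Prop :=
  ClosedConcWithin {C | C ⊆ Icc 0 1 ∧ C.OrdConnected} M

/-! ### Conditional expectations -/

/-- The measure `P` is atomless: every measurable set of positive measure has a measurable subset
of strictly smaller positive measure. -/
def Atomless {Ω : Type*} [MeasurableSpace Ω] (P : Measure Ω) : Prop :=
  ∀ A, MeasurableSet A → 0 < P A → ∃ B, MeasurableSet B ∧ B ⊆ A ∧ 0 < P B ∧ P B < P A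

/-- The law of `X` under `P`. -/
def law {Ω : Type*} {mΩ : MeasurableSpace Ω} (P : Measure Ω) (X : Ω → ℝ) : Measure ℝ := P.map X

/-- `M` is closed under conditional expectation, for random variables on `(Ω, P)`: if the law of
`X` is in `M`, then so is the law of every conditional expectation of `X`. -/
def ClosedCondExp {Ω : Type*} {mΩ : MeasurableSpace Ω} (P : Measure Ω)
    (M : Set (Measure ℝ)) : Prop :=
  ∀ X : Ω → ℝ, Measurable X → law P X ∈ M →
    ∀ 𝓖 : MeasurableSpace Ω, 𝓖 ≤ mΩ → law P (condExp 𝓖 P X) ∈ M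

end DistortionRisk

end

open MeasureTheory Set

noncomputable section

namespace DistortionRisk

/-! ### Extended integrals -/

/-! Subtracting the line $h(1)t$ gives $\rho_h(F)=\int \tilde h(S_F(x))\,dx+h(1)\,\mathbb E[F]$ with
$\tilde h(t)=h(t)-h(1)t$ (`tilt`), because the tail function of $F$ compared with that of the point
mass at $0$ integrates to the mean. Now $\tilde h$ vanishes at $0$ and $1$, and the tilted envelope
$g$ is moreover nonnegative, so $\rho_{h^*}$ is always defined and only positive integrals have to
be approximated from below.

The mechanism is `sub_chordal_conc`. Concentration on the levels $(1-b,1-a)$ sends the tail values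
lying in $(a,b)$ to $a$ or $b$ and keeps the mean. For any $\varphi$, the new $\varphi(S)$ differs
from the old $S$ inserted into "$\varphi$ with its chord on $(a,b)$" by a slope times the difference
of the tails, which integrates to $0$. Thus concentrating the distribution amounts to replacing the
distortion function by chords (`exists_conc`).

For (i), chords of $\tilde h$ between finitely many points where $\tilde h\ge(1-\varepsilon)g$ come
within a factor $1-\varepsilon$ of the corresponding chords of $g$, and the latter increase to $g$
(`exists_approx`). The error is multiplicative because an additive one would not be integrable over
the line.

For (ii), semicontinuity makes the gap set open, and on a gap the envelope is affine, since
otherwise it could be lowered (`le_chord_of_Icc_subset_gapSet`, `chord_eq_on_gap`). So the chord of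
$\tilde h$ over a gap is $g$ itself. Finitely many gaps are handled at once, infinitely many by
exhaustion.

For (iii), concentration on all gaps moves the tail values off the gaps, where $h=h^*$, and keeps
$\rho_{h^*}$ because $h^*$ is affine on them (`rho_concAll_gapIntervals`). It stays in the set
because it is the law of $\mathbb E[q(U)\mid f(U)]$, with $q$ the quantile function, $f$ its
concentration and $U$ a uniform variable, which exists on an atomless space
(`Atomless.exists_uniform`). -/

/-- The integral of the positive part minus the integral of the negative part. -/
def extInt {α : Type*} [MeasurableSpace α] (f : α → ℝ) (μ : Measure α) : EReal :=
  ((∫⁻ x, ENNReal.ofReal (f x) ∂μ : ENNReal) : EReal) -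
    ((∫⁻ x, ENNReal.ofReal (-f x) ∂μ : ENNReal) : EReal)

lemma lintegral_ofReal_ne_top_of_sub {α : Type*} [MeasurableSpace α] {μ : Measure α} {f f' : α → ℝ}
    (hf : Measurable f) (hd : Integrable (fun x => f' x - f x) μ)
    (h : ∫⁻ x, ENNReal.ofReal (f x) ∂μ ≠ ⊤) : ∫⁻ x, ENNReal.ofReal (f' x) ∂μ ≠ ⊤ := by
  have h1 : ∫⁻ x, ENNReal.ofReal (f' x) ∂μ ≤
      ∫⁻ x, (ENNReal.ofReal (f x) + ENNReal.ofReal (f' x - f x)) ∂μ := by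
    refine lintegral_mono fun x => ?_
    refine le_trans (le_of_eq ?_) ENNReal.ofReal_add_le
    congr 1; ring
  refine ne_top_of_le_ne_top ?_ h1
  rw [lintegral_add_left hf.ennreal_ofReal]
  exact ENNReal.add_ne_top.2 ⟨h, hd.lintegral_lt_top.ne⟩

lemma extInt_eq_integral {α : Type*} [MeasurableSpace α] {μ : Measure α} {f : α → ℝ}
    (hf : Integrable f μ) : extInt f μ = ((∫ x, f x ∂μ : ℝ) : EReal) := by
  rw [integral_eq_lintegral_pos_part_sub_lintegral_neg_part hf, extInt, EReal.coe_sub]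
  have h1 := hf.lintegral_lt_top.ne
  have h2 := hf.neg.lintegral_lt_top.ne
  simp only [Pi.neg_apply] at h2
  congr 1
  · exact (EReal.coe_ennreal_toReal h1).symm
  · exact (EReal.coe_ennreal_toReal h2).symm

/-- Changing the integrand by an integrable function changes the extended integral accordingly. -/
lemma extInt_eq_add {α : Type*} [MeasurableSpace α] {μ : Measure α} {f f' : α → ℝ}
    (hf : Measurable f) (hf' : Measurable f') (hd : Integrable (fun x => f' x - f x) μ) :
    extInt f' μ = extInt f μ + ((∫ x, (f' x - f x) ∂μ : ℝ) : EReal) := by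
  have hd2 : Integrable (fun x => f x - f' x) μ :=
    hd.neg.congr (ae_of_all _ fun x => by simp)
  have hn : Integrable (fun x => -f' x - -f x) μ := by
    refine hd2.congr (ae_of_all _ fun x => ?_); simp only; ring
  have hn2 : Integrable (fun x => -f x - -f' x) μ := by
    refine hd.congr (ae_of_all _ fun x => ?_); simp only; ring
  have p1 := lintegral_ofReal_ne_top_of_sub hf hd
  have p2 := lintegral_ofReal_ne_top_of_sub hf' hd2
  have n1 := lintegral_ofReal_ne_top_of_sub hf.neg hn
  have n2 := lintegral_ofReal_ne_top_of_sub hf'.neg hn2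
  simp only [Pi.neg_apply] at n1 n2
  by_cases hp : ∫⁻ x, ENNReal.ofReal (f x) ∂μ = ⊤
  · have hp' : ∫⁻ x, ENNReal.ofReal (f' x) ∂μ = ⊤ := by by_contra h; exact p2 h hp
    by_cases hm : ∫⁻ x, ENNReal.ofReal (-f x) ∂μ = ⊤
    · have hm' : ∫⁻ x, ENNReal.ofReal (-f' x) ∂μ = ⊤ := by by_contra h; exact n2 h hm
      -- In `EReal` one has `⊤ - ⊤ = ⊥`, and `⊥` absorbs the real summand, so the identity survives
      -- where the integral is undefined.
      simp [extInt, hp, hp', hm, hm']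
    · have hm' := n1 hm
      simp only [extInt, hp, hp']
      lift (∫⁻ x, ENNReal.ofReal (-f x) ∂μ) to NNReal using hm with y
      lift (∫⁻ x, ENNReal.ofReal (-f' x) ∂μ) to NNReal using hm' with y'
      simp [EReal.coe_ennreal_top, EReal.coe_nnreal_eq_coe_real]
  · have hp' := p1 hp
    by_cases hm : ∫⁻ x, ENNReal.ofReal (-f x) ∂μ = ⊤
    · have hm' : ∫⁻ x, ENNReal.ofReal (-f' x) ∂μ = ⊤ := by by_contra h; exact n2 h hm
      simp [extInt, hm, hm']
    · have hi : Integrable f μ := by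
        refine ⟨hf.aestronglyMeasurable, ?_⟩
        rw [hasFiniteIntegral_iff_norm]
        have : ∀ x, ENNReal.ofReal ‖f x‖ ≤ ENNReal.ofReal (f x) + ENNReal.ofReal (-f x) := by
          intro x
          rcases le_total 0 (f x) with h | h
          · rw [Real.norm_of_nonneg h]; exact le_self_add
          · rw [Real.norm_of_nonpos h]; exact le_add_self
        refine lt_of_le_of_lt (lintegral_mono this) ?_
        rw [lintegral_add_left hf.ennreal_ofReal]
        exact ENNReal.add_lt_top.2 ⟨Ne.lt_top hp, Ne.lt_top hm⟩
      have hi' : Integrable f' μ := by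
        refine (hi.add hd).congr (ae_of_all _ fun x => ?_)
        simp
      rw [extInt_eq_integral hi, extInt_eq_integral hi', ← EReal.coe_add, integral_sub hi' hi]
      congr 1; ring

lemma extInt_of_nonneg {α : Type*} [MeasurableSpace α] {μ : Measure α} {f : α → ℝ}
    (hf : ∀ x, 0 ≤ f x) : extInt f μ = ((∫⁻ x, ENNReal.ofReal (f x) ∂μ : ENNReal) : EReal) := by
  have : ∀ x, ENNReal.ofReal (-f x) = 0 := fun x => by simp [hf x]
  simp [extInt, this]

/-! ### Tail functions and the mean -/

/-- The integral of the tail function, compared with that of the point mass at `0`, is the mean. -/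
lemma integrable_tail {μ : Measure ℝ} (hμ : μ ∈ finiteMean) :
    Integrable (fun x => μ.real (Ioi x) - if x < 0 then 1 else 0) volume ∧
      ∫ x, (μ.real (Ioi x) - if x < 0 then 1 else 0) = ∫ x, x ∂μ := by
  obtain ⟨hp, hi⟩ := hμ
  set D : ℝ → ℝ := fun x => μ.real (Ioi x) - if x < 0 then 1 else 0 with hD
  have hpos : Integrable (fun x : ℝ => max x 0) μ := hi.pos_part
  have hneg : Integrable (fun x : ℝ => max (-x) 0) μ := hi.neg_part
  have anti : Antitone fun x => μ.real (Ioi x) := fun x y hxy =>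
    measureReal_mono (Ioi_subset_Ioi hxy)
  -- Layer-cake formula for the positive and the negative part of the identity.
  have e1 := hpos.integral_eq_integral_meas_lt (ae_of_all _ fun x => le_max_right x 0)
  have e2 := hneg.integral_eq_integral_meas_lt (ae_of_all _ fun x => le_max_right (-x) 0)
  have l1 := lintegral_eq_lintegral_meas_lt μ (ae_of_all _ fun x => le_max_right x 0)
    hpos.aemeasurable
  have l2 := lintegral_eq_lintegral_meas_lt μ (ae_of_all _ fun x => le_max_right (-x) 0)
    hneg.aemeasurable
  have s1 : ∀ t ∈ Ioi (0:ℝ), {a : ℝ | t < max a 0} = Ioi t := by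
    intro t ht; ext a; simp only [mem_ofPred_eq, mem_Ioi, lt_max_iff] at *
    constructor
    · rintro (h | h)
      · exact h
      · linarith
    · exact fun h => Or.inl h
  have s2 : ∀ t ∈ Ioi (0:ℝ), {a : ℝ | t < max (-a) 0} = Iio (-t) := by
    intro t ht; ext a; simp only [mem_ofPred_eq, mem_Ioi, mem_Iio, lt_max_iff] at *
    constructor
    · rintro (h | h) <;> linarith
    · exact fun h => Or.inl (by linarith)
  rw [setIntegral_congr_fun measurableSet_Ioi
    (g := fun t => μ.real (Ioi t)) (fun t ht => by simp only [s1 t ht])] at e1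
  rw [setIntegral_congr_fun measurableSet_Ioi
    (g := fun t => μ.real (Iio (-t))) (fun t ht => by simp only [s2 t ht])] at e2
  rw [setLIntegral_congr_fun measurableSet_Ioi
    (g := fun t => μ (Ioi t)) (fun t ht => by simp only [s1 t ht])] at l1
  rw [setLIntegral_congr_fun measurableSet_Ioi
    (g := fun t => μ (Iio (-t))) (fun t ht => by simp only [s2 t ht])] at l2
  have i1 : IntegrableOn (fun t => μ.real (Ioi t)) (Ioi 0) := by
    refine ⟨anti.measurable.aestronglyMeasurable, ?_⟩
    rw [hasFiniteIntegral_iff_ofReal (ae_of_all _ fun _ => measureReal_nonneg)]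
    simp only [measureReal_def, ENNReal.ofReal_toReal (measure_ne_top μ _)]
    rw [← l1]; exact hpos.lintegral_lt_top
  have antin : Antitone fun x => μ.real (Iio (-x)) := fun x y hxy =>
    measureReal_mono (Iio_subset_Iio (by linarith))
  have i2 : IntegrableOn (fun t => μ.real (Iio (-t))) (Ioi 0) := by
    refine ⟨antin.measurable.aestronglyMeasurable, ?_⟩
    rw [hasFiniteIntegral_iff_ofReal (ae_of_all _ fun _ => measureReal_nonneg)]
    simp only [measureReal_def, ENNReal.ofReal_toReal (measure_ne_top μ _)]
    rw [← l2]; exact hneg.lintegral_lt_top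
  have i2' : IntegrableOn (fun t => μ.real (Iio t)) (Iio 0) := by
    have := (MeasurePreserving.integrableOn_comp_preimage
      (Measure.measurePreserving_neg (volume : Measure ℝ)) (Homeomorph.neg ℝ).measurableEmbedding
      (f := fun t => μ.real (Iio t)) (s := Iio 0)).1
    refine this ?_
    have h : (fun x : ℝ => -x) ⁻¹' (Iio 0) = Ioi 0 := by ext; simp
    rw [h]; exact i2
  have e2' : ∫ t in Ioi (0:ℝ), μ.real (Iio (-t)) = ∫ t in Iio (0:ℝ), μ.real (Iio t) := by
    have := (MeasurePreserving.setIntegral_preimage_emb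
      (Measure.measurePreserving_neg (volume : Measure ℝ)) (Homeomorph.neg ℝ).measurableEmbedding
      (fun t => μ.real (Iio t)) (Iio 0))
    have h : (fun x : ℝ => -x) ⁻¹' (Iio 0) = Ioi 0 := by ext; simp
    rw [h] at this; exact this
  -- The layer-cake formula for the negative part produces `Iio`, the tail function involves `Iic`.
  -- They differ only at the atoms, which are countable and hence Lebesgue null.
  have cnt : {x : ℝ | μ.real {x} ≠ 0}.Countable := by
    have := Measure.countable_meas_pos_of_disjoint_iUnion (μ := μ) (As := fun x : ℝ => {x})
      (fun x => measurableSet_singleton x) (fun x y hxy => by simpa using hxy)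
    refine this.mono fun x hx => ?_
    simp only [mem_ofPred_eq, measureReal_def, ne_eq, ENNReal.toReal_eq_zero_iff, not_or] at hx ⊢
    exact pos_iff_ne_zero.2 hx.1
  have hae : ∀ᵐ x ∂(volume : Measure ℝ), μ.real (Iio x) = 1 - μ.real (Ioi x) := by
    have : ∀ᵐ x ∂(volume : Measure ℝ), x ∉ {x : ℝ | μ.real {x} ≠ 0} :=
      measure_eq_zero_iff_ae_notMem.1 (cnt.measure_zero _)
    filter_upwards [this] with x hx
    simp only [not_not] at hx
    have h1 : μ.real (Iic x) = μ.real (Iio x) + μ.real {x} := by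
      rw [← Iio_union_right, measureReal_union (by simp) (measurableSet_singleton x)]
    have h2 : μ.real (Iic x) = 1 - μ.real (Ioi x) := by
      rw [← compl_Ioi, probReal_compl_eq_one_sub measurableSet_Ioi]
    linarith
  have j1 : EqOn D (fun t => μ.real (Ioi t)) (Ici 0) := by
    intro t ht; simp only [hD, mem_Ici] at *; rw [if_neg (not_lt.2 ht)]; ring
  have j2 : ∀ᵐ t ∂(volume.restrict (Iio (0:ℝ))), D t = -μ.real (Iio t) := by
    filter_upwards [ae_restrict_of_ae hae, ae_restrict_mem measurableSet_Iio] with t ht h0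
    simp only [hD]; rw [ht, if_pos (mem_Iio.1 h0)]; ring
  have k1 : IntegrableOn D (Ici 0) := by
    refine IntegrableOn.congr_fun ?_ j1.symm measurableSet_Ici
    rwa [integrableOn_Ici_iff_integrableOn_Ioi]
  have k2 : IntegrableOn D (Iio 0) := i2'.neg.congr (by filter_upwards [j2] with t ht; simp [ht])
  have k : Integrable D volume := by
    rw [← integrableOn_univ, ← Iio_union_Ici (a := (0:ℝ))]; exact k2.union k1
  refine ⟨k, ?_⟩
  rw [← setIntegral_univ, ← Iio_union_Ici (a := (0:ℝ)),
    setIntegral_union (by rw [disjoint_left]; intro a; simp) measurableSet_Ici k2 k1,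
    setIntegral_congr_fun measurableSet_Ici j1, integral_congr_ae j2, integral_neg,
    integral_Ici_eq_integral_Ioi, ← e1, ← e2', ← e2, neg_add_eq_sub, ← integral_sub hpos hneg]
  refine integral_congr_ae (ae_of_all _ fun x => ?_)
  simp only
  rcases le_total x 0 with h | h
  · rw [max_eq_right h, max_eq_left (by linarith)]; ring
  · rw [max_eq_left h, max_eq_right (by linarith)]; ring

lemma antitone_tail (μ : Measure ℝ) [IsFiniteMeasure μ] : Antitone fun x => μ.real (Ioi x) :=
  fun _ _ hxy => measureReal_mono (Ioi_subset_Ioi hxy)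

lemma measurable_tail (μ : Measure ℝ) [IsFiniteMeasure μ] : Measurable fun x => μ.real (Ioi x) :=
  (antitone_tail μ).measurable

lemma tail_mem_Icc (μ : Measure ℝ) [IsProbabilityMeasure μ] (x : ℝ) :
    μ.real (Ioi x) ∈ Icc (0 : ℝ) 1 := ⟨measureReal_nonneg, measureReal_le_one⟩

lemma integral_tail_sub {μ ν : Measure ℝ} (hμ : μ ∈ finiteMean) (hν : ν ∈ finiteMean) :
    Integrable (fun x => ν.real (Ioi x) - μ.real (Ioi x)) volume ∧
      ∫ x, (ν.real (Ioi x) - μ.real (Ioi x)) = ∫ x, x ∂ν - ∫ x, x ∂μ := by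
  obtain ⟨h1, e1⟩ := integrable_tail hμ
  obtain ⟨h2, e2⟩ := integrable_tail hν
  have : (fun x => ν.real (Ioi x) - μ.real (Ioi x)) =
      fun x => (ν.real (Ioi x) - if x < 0 then 1 else 0) -
        (μ.real (Ioi x) - if x < 0 then 1 else 0) := by
    funext x; ring
  rw [this]
  exact ⟨h2.sub h1, by rw [integral_sub h2 h1, e1, e2]⟩

/-! ### The riskmetric as an extended integral -/

/-- `h` on `[0,1]` minus the linear function with the same value at `1`. -/
def tilt (h : ℝ → ℝ) : ℝ → ℝ := (Icc (0 : ℝ) 1).indicator fun t => h t - h 1 * t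

lemma tilt_of_mem (h : ℝ → ℝ) {t : ℝ} (ht : t ∈ Icc (0 : ℝ) 1) : tilt h t = h t - h 1 * t :=
  indicator_of_mem ht _

/-- The integrand of the riskmetric. -/
def rhoFun (h : ℝ → ℝ) (μ : Measure ℝ) (x : ℝ) : ℝ :=
  h (μ.real (Ioi x)) - if x < 0 then h 1 else 0

lemma rhoFun_sub_tilt (h : ℝ → ℝ) (μ : Measure ℝ) [IsProbabilityMeasure μ] (x : ℝ) :
    rhoFun h μ x - tilt h (μ.real (Ioi x)) = h 1 * (μ.real (Ioi x) - if x < 0 then 1 else 0) := by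
  rw [tilt_of_mem h (tail_mem_Icc μ x), rhoFun]
  split_ifs <;> ring

lemma lintegral_Iio_Ioi (f : ℝ → ENNReal) :
    ∫⁻ x, f x = (∫⁻ x in Ioi (0:ℝ), f x) + ∫⁻ x in Iio (0:ℝ), f x := by
  rw [← setLIntegral_univ, ← Iio_union_Ici (a := (0:ℝ)),
    lintegral_union measurableSet_Ici (by rw [disjoint_left]; intro a; simp),
    setLIntegral_congr Ioi_ae_eq_Ici.symm, add_comm]

lemma rhoPos_eq (h : ℝ → ℝ) (μ : Measure ℝ) :
    rhoPos h μ = ∫⁻ x, ENNReal.ofReal (rhoFun h μ x) := by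
  rw [lintegral_Iio_Ioi, rhoPos]
  congr 1
  · refine setLIntegral_congr_fun measurableSet_Ioi fun x hx => ?_
    simp [rhoFun, not_lt.2 (le_of_lt (mem_Ioi.1 hx))]
  · refine setLIntegral_congr_fun measurableSet_Iio fun x hx => ?_
    simp [rhoFun, mem_Iio.1 hx]

lemma rhoNeg_eq (h : ℝ → ℝ) (μ : Measure ℝ) :
    rhoNeg h μ = ∫⁻ x, ENNReal.ofReal (-rhoFun h μ x) := by
  rw [lintegral_Iio_Ioi, rhoNeg]
  congr 1
  · refine setLIntegral_congr_fun measurableSet_Ioi fun x hx => ?_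
    simp [rhoFun, not_lt.2 (le_of_lt (mem_Ioi.1 hx))]
  · refine setLIntegral_congr_fun measurableSet_Iio fun x hx => ?_
    simp [rhoFun, mem_Iio.1 hx]

lemma measurable_tilt_tail {h : ℝ → ℝ} (hh : Measurable (tilt h)) (μ : Measure ℝ)
    [IsProbabilityMeasure μ] : Measurable fun x => tilt h (μ.real (Ioi x)) :=
  hh.comp (measurable_tail μ)

lemma measurable_rhoFun {h : ℝ → ℝ} (hh : Measurable (tilt h)) (μ : Measure ℝ)
    [IsProbabilityMeasure μ] : Measurable (rhoFun h μ) := by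
  have : rhoFun h μ = fun x => tilt h (μ.real (Ioi x)) +
      h 1 * (μ.real (Ioi x) - if x < 0 then 1 else 0) := by
    funext x; rw [← rhoFun_sub_tilt]; ring
  rw [this]
  exact (measurable_tilt_tail hh μ).add (((measurable_tail μ).sub
    (Measurable.ite measurableSet_Iio measurable_const measurable_const)).const_mul _)

lemma integrable_rhoFun_sub {h : ℝ → ℝ} {μ : Measure ℝ} (hμ : μ ∈ finiteMean) :
    Integrable (fun x => rhoFun h μ x - tilt h (μ.real (Ioi x))) volume ∧
      ∫ x, (rhoFun h μ x - tilt h (μ.real (Ioi x))) = h 1 * ∫ x, x ∂μ := by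
  have := hμ.1
  simp only [rhoFun_sub_tilt]
  exact ⟨(integrable_tail hμ).1.const_mul _, by rw [integral_const_mul, (integrable_tail hμ).2]⟩

lemma rho_eq {h : ℝ → ℝ} (hh : Measurable (tilt h)) {μ : Measure ℝ} (hμ : μ ∈ finiteMean) :
    rho h μ = extInt (fun x => tilt h (μ.real (Ioi x))) volume +
      ((h 1 * ∫ x, x ∂μ : ℝ) : EReal) := by
  have := hμ.1
  have h1 := extInt_eq_add (measurable_tilt_tail hh μ) (measurable_rhoFun hh μ)
    (integrable_rhoFun_sub hμ).1
  rw [(integrable_rhoFun_sub hμ).2] at h1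
  rw [← h1, rho, rhoPos_eq, rhoNeg_eq, extInt]

lemma rhoNeg_ne_top_iff {h : ℝ → ℝ} (hh : Measurable (tilt h)) {μ : Measure ℝ}
    (hμ : μ ∈ finiteMean) :
    rhoNeg h μ ≠ ⊤ ↔ ∫⁻ x, ENNReal.ofReal (-tilt h (μ.real (Ioi x))) ≠ ⊤ := by
  have := hμ.1
  have i := (integrable_rhoFun_sub (h := h) hμ).1
  rw [rhoNeg_eq]
  constructor
  · refine lintegral_ofReal_ne_top_of_sub (f := fun x => -rhoFun h μ x)
      (f' := fun x => -tilt h (μ.real (Ioi x))) (measurable_rhoFun hh μ).neg ?_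
    refine i.congr (ae_of_all _ fun x => ?_); simp only; ring
  · refine lintegral_ofReal_ne_top_of_sub (f' := fun x => -rhoFun h μ x)
      (f := fun x => -tilt h (μ.real (Ioi x))) (measurable_tilt_tail hh μ).neg ?_
    refine i.neg.congr (ae_of_all _ fun x => ?_); simp only [Pi.neg_apply]; ring

/-! ### Quantile functions -/

lemma real_Iic (μ : Measure ℝ) [IsProbabilityMeasure μ] (x : ℝ) :
    μ.real (Iic x) = 1 - μ.real (Ioi x) := by
  rw [← compl_Ioi, probReal_compl_eq_one_sub measurableSet_Ioi]

/-- Right-continuity of the distribution function turns the infimum into an equivalence. The levels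
$0$ and $1$ are excluded because there the set may be unbounded below or empty, where `sInf` takes
its default value. -/
lemma lt_quantile_iff (μ : Measure ℝ) [IsProbabilityMeasure μ] {u x : ℝ} (hu : u ∈ Ioo (0:ℝ) 1) :
    x < quantile μ u ↔ 1 - μ.real (Ioi x) < u := by
  rw [← real_Iic, quantile]
  have hne : {x : ℝ | u ≤ μ.real (Iic x)}.Nonempty := by
    have := (ProbabilityTheory.tendsto_cdf_atTop μ).eventually (lt_mem_nhds hu.2)
    obtain ⟨y, hy⟩ := this.exists
    rw [ProbabilityTheory.cdf_eq_real] at hy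
    exact ⟨y, hy.le⟩
  have hbdd : BddBelow {x : ℝ | u ≤ μ.real (Iic x)} := by
    have := (ProbabilityTheory.tendsto_cdf_atBot μ).eventually (gt_mem_nhds hu.1)
    obtain ⟨y, hy⟩ := this.exists
    rw [ProbabilityTheory.cdf_eq_real] at hy
    refine ⟨y, fun z hz => ?_⟩
    by_contra h
    have : μ.real (Iic z) ≤ μ.real (Iic y) := measureReal_mono (Iic_subset_Iic.2 (not_le.1 h).le)
    have hz' : u ≤ μ.real (Iic z) := hz
    linarith
  constructor
  · intro h
    have := notMem_of_lt_csInf h hbdd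
    simpa using this
  · intro h
    have hc := (ProbabilityTheory.cdf μ).right_continuous x
    rw [← ProbabilityTheory.cdf_eq_real] at h
    have : ∀ᶠ y in nhdsWithin x (Ioi x), ProbabilityTheory.cdf μ y < u :=
      (hc.mono Ioi_subset_Ici_self).eventually (gt_mem_nhds h)
    obtain ⟨y, hy, hxy⟩ := (this.and self_mem_nhdsWithin).exists
    refine lt_of_lt_of_le hxy (le_csInf hne fun z hz => ?_)
    by_contra hzy
    have : μ.real (Iic z) ≤ μ.real (Iic y) := measureReal_mono (Iic_subset_Iic.2 (not_le.1 hzy).le)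
    rw [ProbabilityTheory.cdf_eq_real] at hy
    have hz' : u ≤ μ.real (Iic z) := hz
    linarith

lemma monotoneOn_quantile (μ : Measure ℝ) [IsProbabilityMeasure μ] :
    MonotoneOn (quantile μ) (Ioo 0 1) := by
  intro u hu v hv huv
  by_contra h
  have h1 := (lt_quantile_iff μ hu).1 (not_le.1 h)
  exact lt_irrefl _ ((lt_quantile_iff μ hv).2 (h1.trans_le huv))

instance : IsProbabilityMeasure unif := ⟨by simp [unif]⟩

lemma unif_eq : unif = volume.restrict (Ioo (0:ℝ) 1) :=
  (Measure.restrict_congr_set Ioo_ae_eq_Icc).symm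

lemma aemeasurable_unif_of_monotoneOn {f : ℝ → ℝ} (hf : MonotoneOn f (Ioo 0 1)) :
    AEMeasurable f unif := by
  rw [unif_eq]; exact aemeasurable_restrict_of_monotoneOn measurableSet_Ioo hf

/-- The criterion by which every tail function below is computed: the event that $f$ exceeds $x$
only has to be, up to a null set, the levels above $1-s$. -/
lemma map_unif_real_Ioi {f : ℝ → ℝ} (hf : AEMeasurable f unif) {x s : ℝ} (hs : s ∈ Icc (0:ℝ) 1)
    (h : ∀ᵐ u ∂(volume : Measure ℝ), u ∈ Ioo (0:ℝ) 1 → (x < f u ↔ 1 - s < u)) :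
    (unif.map f).real (Ioi x) = s := by
  rw [map_measureReal_apply_of_aemeasurable hf measurableSet_Ioi, measureReal_def]
  have : f ⁻¹' Ioi x =ᵐ[unif] Ioi (1 - s) := by
    rw [unif_eq]
    filter_upwards [ae_restrict_of_ae h, ae_restrict_mem measurableSet_Ioo] with u hu h0
    exact propext (hu h0)
  rw [measure_congr this, unif, Measure.restrict_apply measurableSet_Ioi]
  have : Ioi (1 - s) ∩ Icc 0 1 = Ioc (1 - s) 1 := by
    ext u
    simp only [mem_inter_iff, mem_Ioi, mem_Icc, mem_Ioc]
    constructor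
    · rintro ⟨h1, h2, h3⟩; exact ⟨h1, h3⟩
    · rintro ⟨h1, h2⟩; exact ⟨h1, by linarith [hs.2], h2⟩
  rw [this, Real.volume_Ioc, ENNReal.toReal_ofReal] <;> linarith [hs.1]

lemma eq_of_tail_eq {μ ν : Measure ℝ} [IsProbabilityMeasure μ] [IsProbabilityMeasure ν]
    (h : ∀ x, μ.real (Ioi x) = ν.real (Ioi x)) : μ = ν := by
  refine Measure.ext_of_Iic _ _ fun x => ?_
  have : μ.real (Iic x) = ν.real (Iic x) := by rw [real_Iic, real_Iic, h]
  exact (measureReal_eq_measureReal_iff).1 this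

lemma map_quantile (μ : Measure ℝ) [IsProbabilityMeasure μ] : unif.map (quantile μ) = μ := by
  have hm := aemeasurable_unif_of_monotoneOn (monotoneOn_quantile μ)
  have := Measure.isProbabilityMeasure_map hm
  refine eq_of_tail_eq fun x => ?_
  exact map_unif_real_Ioi hm (tail_mem_Icc μ x) (ae_of_all _ fun u hu => lt_quantile_iff μ hu)

lemma integrable_quantile {μ : Measure ℝ} (hμ : μ ∈ finiteMean) :
    Integrable (quantile μ) unif ∧ ∫ u, quantile μ u ∂unif = ∫ x, x ∂μ := by
  have := hμ.1
  have hm := aemeasurable_unif_of_monotoneOn (monotoneOn_quantile μ)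
  have h := hμ.2
  constructor
  · rw [← map_quantile μ] at h
    exact h.comp_aemeasurable hm
  · conv_rhs => rw [← map_quantile μ]
    rw [integral_map hm (by fun_prop)]

/-! ### Families of disjoint intervals -/

/-- The interval of levels that corresponds to the interval `(p.1, p.2)` of tail probabilities. -/
def levels (p : ℝ × ℝ) : Set ℝ := Ioo (1 - p.2) (1 - p.1)

/-- `J` consists of (the endpoints of) disjoint nondegenerate open subintervals of `[0,1]`. -/
structure IsFamily (J : Set (ℝ × ℝ)) : Prop where
  nonneg : ∀ p ∈ J, 0 ≤ p.1
  lt : ∀ p ∈ J, p.1 < p.2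
  le_one : ∀ p ∈ J, p.2 ≤ 1
  disj : ∀ p ∈ J, ∀ q ∈ J, ∀ t, t ∈ Ioo p.1 p.2 → t ∈ Ioo q.1 q.2 → p = q

lemma IsFamily.mono {J K : Set (ℝ × ℝ)} (hJ : IsFamily J) (h : K ⊆ J) : IsFamily K :=
  ⟨fun p hp => hJ.1 p (h hp), fun p hp => hJ.2 p (h hp), fun p hp => hJ.3 p (h hp),
    fun p hp q hq => hJ.4 p (h hp) q (h hq)⟩

lemma isFamily_singleton {p : ℝ × ℝ} (h0 : 0 ≤ p.1) (h : p.1 < p.2) (h1 : p.2 ≤ 1) :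
    IsFamily {p} :=
  ⟨by rintro _ rfl; exact h0, by rintro _ rfl; exact h, by rintro _ rfl; exact h1,
    by rintro _ rfl _ rfl; simp⟩

lemma mem_levels_iff {p : ℝ × ℝ} {u : ℝ} : u ∈ levels p ↔ 1 - u ∈ Ioo p.1 p.2 := by
  simp only [levels, mem_Ioo]; constructor <;> rintro ⟨h1, h2⟩ <;> constructor <;> linarith

lemma IsFamily.levels_subset {J : Set (ℝ × ℝ)} (hJ : IsFamily J) {p : ℝ × ℝ} (hp : p ∈ J) :
    levels p ⊆ Ioo 0 1 := by
  intro u hu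
  have h0 := hJ.nonneg p hp
  have h1 := hJ.le_one p hp
  exact ⟨by linarith [hu.1], by linarith [hu.2]⟩

lemma IsFamily.levels_disj {J : Set (ℝ × ℝ)} (hJ : IsFamily J) {p q : ℝ × ℝ} (hp : p ∈ J)
    (hq : q ∈ J) {u : ℝ} (h1 : u ∈ levels p) (h2 : u ∈ levels q) : p = q :=
  hJ.disj p hp q hq _ (mem_levels_iff.1 h1) (mem_levels_iff.1 h2)

/-- For disjoint intervals, if a point of one is below a point of another one, then the whole
intervals are ordered. -/
lemma IsFamily.le_of_le {J : Set (ℝ × ℝ)} (hJ : IsFamily J) {p q : ℝ × ℝ} (hp : p ∈ J)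
    (hq : q ∈ J) (hpq : p ≠ q) {s t : ℝ} (hs : s ∈ Ioo p.1 p.2) (ht : t ∈ Ioo q.1 q.2)
    (hst : s ≤ t) : p.2 ≤ q.1 := by
  by_contra h
  push Not at h
  -- The midpoint of the overlap of the two intervals.
  refine hpq (hJ.disj p hp q hq ((max q.1 p.1 + min p.2 q.2) / 2) ?_ ?_)
  all_goals
    have hlt : max q.1 p.1 < min p.2 q.2 :=
      max_lt (lt_min h (ht.1.trans ht.2)) (lt_min (hs.1.trans hs.2) (by linarith [hs.1, ht.2]))
    have h1 := le_max_left q.1 p.1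
    have h2 := le_max_right q.1 p.1
    have h3 := min_le_left p.2 q.2
    have h4 := min_le_right p.2 q.2
    constructor <;> linarith

lemma IsFamily.countable {J : Set (ℝ × ℝ)} (hJ : IsFamily J) : J.Countable := by
  refine PairwiseDisjoint.countable_of_isOpen (s := fun p : ℝ × ℝ => Ioo p.1 p.2) ?_
    (fun p _ => isOpen_Ioo) (fun p hp => nonempty_Ioo.2 (hJ.lt p hp))
  intro p hp q hq hpq
  exact disjoint_left.2 fun t h1 h2 => hpq (hJ.disj p hp q hq t h1 h2)

/-! ### Concentration -/

/-- The mean value of the quantile function over an interval of levels. -/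
def avg (μ : Measure ℝ) (p : ℝ × ℝ) : ℝ := ⨍ v in levels p, quantile μ v

open Classical in
/-- The concentrated quantile function. -/
def concFun (𝓘 : Set (Set ℝ)) (μ : Measure ℝ) (u : ℝ) : ℝ :=
  (if u ∈ ⋃₀ 𝓘 then 0 else quantile μ u) +
    ∑ᶠ C ∈ 𝓘, C.indicator (fun _ => ⨍ v in C, quantile μ v) u

lemma concAll_eq (𝓘 : Set (Set ℝ)) (μ : Measure ℝ) : concAll 𝓘 μ = unif.map (concFun 𝓘 μ) := rfl

/-- At a given level at most one interval contributes, so the `finsum` has at most one nonzero term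
and never falls back to its default value, even for infinite families. -/
lemma concFun_of_mem {J : Set (ℝ × ℝ)} (hJ : IsFamily J) (μ : Measure ℝ) {p : ℝ × ℝ} (hp : p ∈ J)
    {u : ℝ} (hu : u ∈ levels p) : concFun (levels '' J) μ u = avg μ p := by
  have h1 : u ∈ ⋃₀ (levels '' J) := ⟨levels p, mem_image_of_mem _ hp, hu⟩
  rw [concFun, if_pos h1, zero_add]
  rw [finsum_mem_inter_support_eq _ _ {levels p}, finsum_mem_singleton,
    indicator_of_mem hu, avg]
  ext C
  simp only [mem_inter_iff, mem_image, mem_singleton_iff, Function.mem_support]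
  constructor
  · rintro ⟨⟨q, hq, rfl⟩, h⟩
    have : u ∈ levels q := by by_contra h'; exact h (indicator_of_notMem h' _)
    rw [hJ.levels_disj hp hq hu this]
    exact ⟨rfl, h⟩
  · rintro ⟨rfl, h⟩
    exact ⟨⟨p, hp, rfl⟩, h⟩

lemma concFun_of_notMem {J : Set (ℝ × ℝ)} (μ : Measure ℝ) {u : ℝ} (hu : ∀ p ∈ J, u ∉ levels p) :
    concFun (levels '' J) μ u = quantile μ u := by
  have h1 : u ∉ ⋃₀ (levels '' J) := by
    rintro ⟨_, ⟨p, hp, rfl⟩, h⟩; exact hu p hp h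
  rw [concFun, if_neg h1]
  rw [finsum_mem_eq_zero_of_forall_eq_zero, add_zero]
  rintro _ ⟨p, hp, rfl⟩
  exact indicator_of_notMem (hu p hp) _

lemma conc_eq_concAll (C : Set ℝ) (μ : Measure ℝ) : conc C μ = concAll {C} μ := by
  rw [conc, concAll]
  congr 1
  funext u
  by_cases h : u ∈ C <;> simp [h]

lemma volume_levels_ne {J : Set (ℝ × ℝ)} (hJ : IsFamily J) {p : ℝ × ℝ} (hp : p ∈ J) :
    volume (levels p) ≠ 0 ∧ volume (levels p) ≠ ⊤ := by
  have := hJ.lt p hp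
  simp only [levels, Real.volume_Ioo]
  exact ⟨by simp only [ne_eq, ENNReal.ofReal_eq_zero, not_le]; linarith, ENNReal.ofReal_ne_top⟩

lemma unif_restrict_levels {J : Set (ℝ × ℝ)} (hJ : IsFamily J) {p : ℝ × ℝ} (hp : p ∈ J) :
    unif.restrict (levels p) = volume.restrict (levels p) := by
  rw [unif_eq, Measure.restrict_restrict (show MeasurableSet (levels p) from measurableSet_Ioo),
    inter_eq_left.2 (hJ.levels_subset hp)]

lemma integrableOn_quantile_levels {μ : Measure ℝ} (hμ : μ ∈ finiteMean) {J : Set (ℝ × ℝ)}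
    (hJ : IsFamily J) {p : ℝ × ℝ} (hp : p ∈ J) : IntegrableOn (quantile μ) (levels p) := by
  rw [IntegrableOn, ← unif_restrict_levels hJ hp]
  exact (integrable_quantile hμ).1.integrableOn

/-- With the mirror image below, this places the average between two values of the quantile function
inside the interval, which is what order arguments about the concentrated quantile function need. -/
lemma exists_quantile_le_avg {μ : Measure ℝ} (hμ : μ ∈ finiteMean) {J : Set (ℝ × ℝ)}
    (hJ : IsFamily J) {p : ℝ × ℝ} (hp : p ∈ J) : ∃ u ∈ levels p, quantile μ u ≤ avg μ p :=
  exists_le_setAverage (volume_levels_ne hJ hp).1 (volume_levels_ne hJ hp).2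
    (integrableOn_quantile_levels hμ hJ hp)

lemma exists_avg_le_quantile {μ : Measure ℝ} (hμ : μ ∈ finiteMean) {J : Set (ℝ × ℝ)}
    (hJ : IsFamily J) {p : ℝ × ℝ} (hp : p ∈ J) : ∃ u ∈ levels p, avg μ p ≤ quantile μ u :=
  exists_setAverage_le (volume_levels_ne hJ hp).1 (volume_levels_ne hJ hp).2
    (integrableOn_quantile_levels hμ hJ hp)

lemma monotoneOn_concFun {μ : Measure ℝ} (hμ : μ ∈ finiteMean) {J : Set (ℝ × ℝ)}
    (hJ : IsFamily J) : MonotoneOn (concFun (levels '' J) μ) (Ioo 0 1) := by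
  have := hμ.1
  have hq := monotoneOn_quantile μ
  intro u hu v hv huv
  by_cases h1 : ∃ p ∈ J, u ∈ levels p
  · obtain ⟨p, hp, hup⟩ := h1
    rw [concFun_of_mem hJ μ hp hup]
    obtain ⟨u', hu', hle⟩ := exists_avg_le_quantile hμ hJ hp
    by_cases h2 : ∃ q ∈ J, v ∈ levels q
    · obtain ⟨q, hq', hvq⟩ := h2
      rw [concFun_of_mem hJ μ hq' hvq]
      by_cases hpq : p = q
      · rw [hpq]
      · obtain ⟨v', hv', hle'⟩ := exists_quantile_le_avg hμ hJ hq'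
        have := hJ.le_of_le hq' hp (Ne.symm hpq) (mem_levels_iff.1 hvq) (mem_levels_iff.1 hup)
          (by linarith)
        refine hle.trans ((hq (hJ.levels_subset hp hu') (hJ.levels_subset hq' hv') ?_).trans hle')
        linarith [hu'.2, hv'.1]
    · push Not at h2
      rw [concFun_of_notMem μ h2]
      refine hle.trans (hq (hJ.levels_subset hp hu') hv ?_)
      have : ¬ v < 1 - p.1 := fun h => h2 p hp ⟨by linarith [hup.1], h⟩
      linarith [hu'.2]
  · push Not at h1
    rw [concFun_of_notMem μ h1]
    by_cases h2 : ∃ q ∈ J, v ∈ levels q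
    · obtain ⟨q, hq', hvq⟩ := h2
      rw [concFun_of_mem hJ μ hq' hvq]
      obtain ⟨v', hv', hle'⟩ := exists_quantile_le_avg hμ hJ hq'
      refine (hq hu (hJ.levels_subset hq' hv') ?_).trans hle'
      have : ¬ 1 - q.2 < u := fun h => h1 q hq' ⟨h, by linarith [hvq.2]⟩
      linarith [hv'.1]
    · push Not at h2
      rw [concFun_of_notMem μ h2]
      exact hq hu hv huv

lemma aemeasurable_concFun {μ : Measure ℝ} (hμ : μ ∈ finiteMean) {J : Set (ℝ × ℝ)}
    (hJ : IsFamily J) : AEMeasurable (concFun (levels '' J) μ) unif :=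
  aemeasurable_unif_of_monotoneOn (monotoneOn_concFun hμ hJ)

/-- If $S(x)$ does not lie strictly inside an interval, the level $1-S(x)$ does not cut the
corresponding level interval. All quantiles there lie on the same side of $x$, hence so does their
average. -/
lemma lt_concFun_iff {μ : Measure ℝ} (hμ : μ ∈ finiteMean) {J : Set (ℝ × ℝ)}
    (hJ : IsFamily J) {u x : ℝ} (hu : u ∈ Ioo (0:ℝ) 1)
    (h : ∀ p ∈ J, u ∈ levels p → μ.real (Ioi x) ∉ Ioo p.1 p.2) :
    x < concFun (levels '' J) μ u ↔ 1 - μ.real (Ioi x) < u := by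
  have := hμ.1
  by_cases h1 : ∃ p ∈ J, u ∈ levels p
  · obtain ⟨p, hp, hup⟩ := h1
    rw [concFun_of_mem hJ μ hp hup]
    rcases le_or_gt (μ.real (Ioi x)) p.1 with hs | hs
    · obtain ⟨v, hv, hle⟩ := exists_avg_le_quantile hμ hJ hp
      have h1 : ¬ x < quantile μ v := by
        rw [lt_quantile_iff μ (hJ.levels_subset hp hv)]; linarith [hv.2]
      constructor
      · intro h2; exact absurd (h2.trans_le hle) h1
      · intro h2; linarith [hup.2]
    · have hs2 : p.2 ≤ μ.real (Ioi x) := by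
        by_contra h3; exact h p hp hup ⟨hs, not_le.1 h3⟩
      obtain ⟨v, hv, hle⟩ := exists_quantile_le_avg hμ hJ hp
      have h1 : x < quantile μ v := by
        rw [lt_quantile_iff μ (hJ.levels_subset hp hv)]; linarith [hv.1]
      exact ⟨fun _ => by linarith [hup.1], fun _ => h1.trans_le hle⟩
  · push Not at h1
    rw [concFun_of_notMem μ h1, lt_quantile_iff μ hu]

/-- The tail function of a concentration, where the original tail function is not in one of the
intervals. -/
lemma tail_concAll_of_notMem {μ : Measure ℝ} (hμ : μ ∈ finiteMean) {J : Set (ℝ × ℝ)}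
    (hJ : IsFamily J) {x : ℝ} (h : ∀ p ∈ J, μ.real (Ioi x) ∉ Ioo p.1 p.2) :
    (concAll (levels '' J) μ).real (Ioi x) = μ.real (Ioi x) := by
  have := hμ.1
  exact map_unif_real_Ioi (aemeasurable_concFun hμ hJ) (tail_mem_Icc μ x)
    (ae_of_all _ fun u hu => lt_concFun_iff hμ hJ hu fun p hp _ => h p hp)

/-- The tail function of a concentration, where the original tail function is in one of the
intervals. -/
lemma tail_concAll_of_mem {μ : Measure ℝ} (hμ : μ ∈ finiteMean) {J : Set (ℝ × ℝ)}
    (hJ : IsFamily J) {x : ℝ} {p : ℝ × ℝ} (hp : p ∈ J) (h : μ.real (Ioi x) ∈ Ioo p.1 p.2) :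
    (concAll (levels '' J) μ).real (Ioi x) = if x < avg μ p then p.2 else p.1 := by
  have h0 := hJ.nonneg p hp
  have h1 := hJ.le_one p hp
  have h2 := hJ.lt p hp
  refine map_unif_real_Ioi (aemeasurable_concFun hμ hJ) ?_ ?_
  · split_ifs <;> constructor <;> linarith
  -- The equivalence is needed almost everywhere only; the two endpoint levels, which this interval
  -- does not contain, are discarded.
  · have hn : ∀ a : ℝ, ∀ᵐ u ∂(volume : Measure ℝ), u ≠ a := fun a => by
      simp [ae_iff]
    filter_upwards [hn (1 - p.1), hn (1 - p.2)] with u hu1 hu2 hu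
    by_cases hup : u ∈ levels p
    · rw [concFun_of_mem hJ μ hp hup]
      split_ifs with hx
      · exact ⟨fun _ => hup.1, fun _ => hx⟩
      · exact ⟨fun h => absurd h hx, fun h => absurd hup.2 (not_lt.2 h.le)⟩
    · rw [lt_concFun_iff hμ hJ hu]
      · have : u < 1 - p.2 ∨ 1 - p.1 < u := by
          by_contra hc
          push Not at hc
          exact hup ⟨lt_of_le_of_ne hc.1 (Ne.symm hu2), lt_of_le_of_ne hc.2 hu1⟩
        have hs := h.1
        have hs' := h.2
        split_ifs <;> rcases this with h3 | h3 <;> constructor <;> intro <;> linarith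
      · intro q hq huq hs
        have := hJ.disj p hp q hq _ h hs
        exact hup (this ▸ huq)

/-- This is the defining property of a conditional expectation: a set that cuts none of the
intervals contains each of them entirely or not at all, and averaging keeps the integral over each.
The case of the whole space gives conservation of the mean. -/
lemma concFun_setIntegral {μ : Measure ℝ} (hμ : μ ∈ finiteMean) {J : Set (ℝ × ℝ)}
    (hJ : IsFamily J) :
    Integrable (concFun (levels '' J) μ) unif ∧
      ∀ B, MeasurableSet B → (∀ p ∈ J, levels p ⊆ B ∨ Disjoint (levels p) B) →
        ∫ u in B, concFun (levels '' J) μ u ∂unif = ∫ u in B, quantile μ u ∂unif := by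
  have := hμ.1
  have hc : Countable J := hJ.countable.to_subtype
  set f := concFun (levels '' J) μ with hf
  set W : Set ℝ := ⋃ p : J, levels p with hW
  have mL : ∀ p : ℝ × ℝ, MeasurableSet (levels p) := fun p => measurableSet_Ioo
  have mW : MeasurableSet W := MeasurableSet.iUnion fun p => mL p
  have hd : Pairwise (Function.onFun Disjoint fun p : J => levels p) := by
    intro p q hpq
    exact disjoint_left.2 fun u h1 h2 => hpq (Subtype.ext (hJ.levels_disj p.2 q.2 h1 h2))
  have hq := (integrable_quantile hμ).1
  have hfm := (aemeasurable_concFun hμ hJ).aestronglyMeasurable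
  have hWc : ∀ u ∈ Wᶜ, f u = quantile μ u := by
    intro u hu
    refine concFun_of_notMem μ fun p hp hup => hu ?_
    exact mem_iUnion.2 ⟨⟨p, hp⟩, hup⟩
  have piece : ∀ p : J, ∫ u in levels p, f u ∂unif = ∫ u in levels p, quantile μ u ∂unif := by
    intro p
    rw [unif_restrict_levels hJ p.2]
    rw [setIntegral_congr_fun (mL p) (g := fun _ => avg μ p)
      (fun u hu => concFun_of_mem hJ μ p.2 hu), setIntegral_const]
    exact measure_smul_setAverage _ (volume_levels_ne hJ p.2).2
  -- Averaging does not increase the $L^1$ norm on an interval; summation over the countable family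
  -- then gives integrability.
  have pieceL : ∀ p : J,
      ∫⁻ u in levels p, ‖f u‖ₑ ∂unif ≤ ∫⁻ u in levels p, ‖quantile μ u‖ₑ ∂unif := by
    intro p
    rw [unif_restrict_levels hJ p.2]
    rw [setLIntegral_congr_fun (mL p) (g := fun _ => ‖avg μ p‖ₑ)
      (fun u hu => by rw [hf, concFun_of_mem hJ μ p.2 hu]), setLIntegral_const]
    have h1 := measure_smul_setAverage (μ := volume) (quantile μ) (volume_levels_ne hJ p.2).2
    have h2 := enorm_integral_le_lintegral_enorm (μ := volume.restrict (levels p)) (quantile μ)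
    rw [← h1, smul_eq_mul, enorm_mul] at h2
    rw [mul_comm]
    refine le_trans (le_of_eq ?_) h2
    rw [avg, Real.enorm_of_nonneg measureReal_nonneg, measureReal_def,
      ENNReal.ofReal_toReal (volume_levels_ne hJ p.2).2]
  have iW : IntegrableOn f W unif := by
    refine ⟨hfm.restrict, ?_⟩
    rw [HasFiniteIntegral, hW, lintegral_iUnion (fun p : J => mL p) hd]
    refine lt_of_le_of_lt (ENNReal.tsum_le_tsum pieceL) ?_
    rw [← lintegral_iUnion (fun p : J => mL p) hd]
    exact hq.integrableOn.2
  have iWc : IntegrableOn f Wᶜ unif :=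
    hq.integrableOn.congr_fun (fun u hu => (hWc u hu).symm) mW.compl
  have hi : Integrable f unif := by
    rw [← integrableOn_univ, ← union_compl_self W]; exact iW.union iWc
  refine ⟨hi, fun B mB hB => ?_⟩
  have split : ∀ g : ℝ → ℝ, Integrable g unif → ∫ u in B, g u ∂unif =
      ∑' p : J, ∫ u in levels p ∩ B, g u ∂unif + ∫ u in Wᶜ ∩ B, g u ∂unif := by
    intro g hg
    have e : B = (⋃ p : J, levels p ∩ B) ∪ (Wᶜ ∩ B) := by
      rw [← iUnion_inter, ← union_inter_distrib_right, union_compl_self, univ_inter]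
    conv_lhs => rw [e]
    rw [setIntegral_union _ (mW.compl.inter mB) hg.integrableOn hg.integrableOn,
      integral_iUnion (fun p : J => (mL p).inter mB) _ hg.integrableOn]
    · intro p q hpq
      exact (hd hpq).mono inter_subset_left inter_subset_left
    · rw [← iUnion_inter]
      exact (disjoint_compl_right (a := W)).mono inter_subset_left inter_subset_left
  rw [split f hi, split _ hq]
  congr 1
  · congr 1
    funext p
    rcases hB p p.2 with h | h
    · rw [inter_eq_left.2 h, piece]
    · rw [h.inter_eq]; simp
  · exact setIntegral_congr_fun (mW.compl.inter mB) fun u hu => hWc u hu.1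

lemma concAll_mem_finiteMean {μ : Measure ℝ} (hμ : μ ∈ finiteMean) {J : Set (ℝ × ℝ)}
    (hJ : IsFamily J) :
    concAll (levels '' J) μ ∈ finiteMean ∧ ∫ x, x ∂(concAll (levels '' J) μ) = ∫ x, x ∂μ := by
  have := hμ.1
  have hm := aemeasurable_concFun hμ hJ
  obtain ⟨hi, he⟩ := concFun_setIntegral hμ hJ
  refine ⟨⟨Measure.isProbabilityMeasure_map hm, ?_⟩, ?_⟩
  · rw [concAll_eq]
    exact (integrable_map_measure (by fun_prop) hm).2 hi
  · rw [concAll_eq, integral_map hm (by fun_prop), ← (integrable_quantile hμ).2]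
    have := he univ MeasurableSet.univ (fun p _ => Or.inl (subset_univ _))
    simpa using this

/-! ### Chord replacement -/

/-- The line through two points of the graph of `φ`. -/
def chord (φ : ℝ → ℝ) (p : ℝ × ℝ) (t : ℝ) : ℝ :=
  φ p.1 + (φ p.2 - φ p.1) / (p.2 - p.1) * (t - p.1)

/-- Replace `φ` by its chords on finitely many intervals. -/
def chordal (J : Finset (ℝ × ℝ)) (φ : ℝ → ℝ) (t : ℝ) : ℝ :=
  φ t + ∑ p ∈ J, (Ioo p.1 p.2).indicator (fun t => chord φ p t - φ t) t

lemma chordal_of_notMem {J : Finset (ℝ × ℝ)} (φ : ℝ → ℝ) {t : ℝ}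
    (ht : ∀ p ∈ J, t ∉ Ioo p.1 p.2) : chordal J φ t = φ t := by
  rw [chordal, Finset.sum_eq_zero fun p hp => indicator_of_notMem (ht p hp) _, add_zero]

lemma chordal_of_mem {J : Finset (ℝ × ℝ)} (hJ : IsFamily (J : Set (ℝ × ℝ))) (φ : ℝ → ℝ) {t : ℝ}
    {p : ℝ × ℝ} (hp : p ∈ J) (ht : t ∈ Ioo p.1 p.2) : chordal J φ t = chord φ p t := by
  rw [chordal, Finset.sum_eq_single p, indicator_of_mem ht]
  · ring
  · intro q hq hqp
    exact indicator_of_notMem (fun h => hqp (hJ.disj q hq p hp t h ht)) _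
  · exact fun h => absurd hp h

lemma measurable_chordal (J : Finset (ℝ × ℝ)) {φ : ℝ → ℝ} (hφ : Measurable φ) :
    Measurable (chordal J φ) := by
  refine hφ.add (Finset.measurable_sum _ fun p _ => Measurable.indicator ?_ measurableSet_Ioo)
  unfold chord
  fun_prop

lemma IsFamily.endpoints_notMem {J : Set (ℝ × ℝ)} (hJ : IsFamily J) {p q : ℝ × ℝ} (hp : p ∈ J)
    (hq : q ∈ J) : p.1 ∉ Ioo q.1 q.2 ∧ p.2 ∉ Ioo q.1 q.2 := by
  have h1 := hJ.lt p hp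
  constructor <;> intro h
  · have hpq : p ≠ q := by rintro rfl; exact lt_irrefl _ h.1
    refine hpq (hJ.disj p hp q hq ((p.1 + min p.2 q.2) / 2) ?_ ?_)
    all_goals
      have hlt : p.1 < min p.2 q.2 := lt_min h1 h.2
      have h3 := min_le_left p.2 q.2
      have h4 := min_le_right p.2 q.2
      constructor <;> linarith [h.1]
  · have hpq : p ≠ q := by rintro rfl; exact lt_irrefl _ h.2
    refine hpq (hJ.disj p hp q hq ((max p.1 q.1 + p.2) / 2) ?_ ?_)
    all_goals
      have hlt : max p.1 q.1 < p.2 := max_lt h1 h.1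
      have h3 := le_max_left p.1 q.1
      have h4 := le_max_right p.1 q.1
      constructor <;> linarith [h.2]

/-- No interval of the family contains an endpoint of another one. Hence inserting the chord over
`p` leaves the chords over the other intervals unchanged, and the replacements can be made one at a
time. -/
lemma chordal_insert {J : Finset (ℝ × ℝ)} {p : ℝ × ℝ} (hpJ : p ∉ J)
    (hJ : IsFamily ((insert p J : Finset (ℝ × ℝ)) : Set (ℝ × ℝ))) (φ : ℝ → ℝ) :
    chordal J (chordal {p} φ) = chordal (insert p J) φ := by
  have hJ' : IsFamily (J : Set (ℝ × ℝ)) := hJ.mono (by simp)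
  have hp' : IsFamily (({p} : Finset (ℝ × ℝ)) : Set (ℝ × ℝ)) := hJ.mono (by simp)
  have hpm : p ∈ insert p J := Finset.mem_insert_self p J
  funext t
  by_cases h : ∃ q ∈ J, t ∈ Ioo q.1 q.2
  · obtain ⟨q, hq, ht⟩ := h
    have hqm : q ∈ insert p J := Finset.mem_insert_of_mem hq
    rw [chordal_of_mem hJ' _ hq ht, chordal_of_mem hJ _ hqm ht]
    have he := hJ.endpoints_notMem (p := q) (q := p) hqm hpm
    rw [chord, chord, chordal_of_notMem φ (by simpa using he.1),
      chordal_of_notMem φ (by simpa using he.2)]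
  · push Not at h
    rw [chordal_of_notMem _ h]
    by_cases ht : t ∈ Ioo p.1 p.2
    · rw [chordal_of_mem hp' φ (Finset.mem_singleton_self p) ht, chordal_of_mem hJ φ hpm ht]
    · rw [chordal_of_notMem φ (by simpa using ht), chordal_of_notMem φ]
      intro q hq
      rcases Finset.mem_insert.1 hq with rfl | hq
      · exact ht
      · exact h q hq

/-- Where the old tail lies in the interval, the new one is an endpoint, at which $\varphi$ agrees
with its chord; two values on a line differ by slope times distance. Elsewhere the tail is unchanged
and both sides vanish. No regularity of $\varphi$ is involved. -/
lemma sub_chordal_conc {μ : Measure ℝ} (hμ : μ ∈ finiteMean) {p : ℝ × ℝ} (h0 : 0 ≤ p.1)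
    (h : p.1 < p.2) (h1 : p.2 ≤ 1) (φ : ℝ → ℝ) (x : ℝ) :
    φ ((conc (levels p) μ).real (Ioi x)) - chordal {p} φ (μ.real (Ioi x)) =
      (φ p.2 - φ p.1) / (p.2 - p.1) * ((conc (levels p) μ).real (Ioi x) - μ.real (Ioi x)) := by
  have hJ := isFamily_singleton h0 h h1
  have hJ' : IsFamily (({p} : Finset (ℝ × ℝ)) : Set (ℝ × ℝ)) := by simpa using hJ
  have hp : p ∈ ({p} : Set (ℝ × ℝ)) := rfl
  have e : conc (levels p) μ = concAll (levels '' {p}) μ := by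
    rw [conc_eq_concAll, image_singleton]
  have hne : p.2 - p.1 ≠ 0 := by linarith
  rw [e]
  by_cases hs : μ.real (Ioi x) ∈ Ioo p.1 p.2
  · rw [tail_concAll_of_mem hμ hJ hp hs, chordal_of_mem hJ' φ (Finset.mem_singleton_self p) hs,
      chord]
    split_ifs
    · field_simp; ring
    · ring
  · rw [tail_concAll_of_notMem hμ hJ (by rintro q rfl; exact hs),
      chordal_of_notMem φ (by simpa using hs)]
    ring

lemma conc_mem_finiteMean {μ : Measure ℝ} (hμ : μ ∈ finiteMean) {p : ℝ × ℝ} (h0 : 0 ≤ p.1)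
    (h : p.1 < p.2) (h1 : p.2 ≤ 1) :
    conc (levels p) μ ∈ finiteMean ∧ ∫ x, x ∂(conc (levels p) μ) = ∫ x, x ∂μ := by
  have := concAll_mem_finiteMean hμ (isFamily_singleton h0 h h1)
  rwa [image_singleton, ← conc_eq_concAll] at this

lemma integrable_sub_chordal_conc {μ : Measure ℝ} (hμ : μ ∈ finiteMean) {p : ℝ × ℝ} (h0 : 0 ≤ p.1)
    (h : p.1 < p.2) (h1 : p.2 ≤ 1) (φ : ℝ → ℝ) :
    Integrable (fun x => φ ((conc (levels p) μ).real (Ioi x)) -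
        chordal {p} φ (μ.real (Ioi x))) volume ∧
      ∫ x, (φ ((conc (levels p) μ).real (Ioi x)) - chordal {p} φ (μ.real (Ioi x))) = 0 := by
  simp only [sub_chordal_conc hμ h0 h h1]
  obtain ⟨hν, he⟩ := conc_mem_finiteMean hμ h0 h h1
  obtain ⟨hi, he'⟩ := integral_tail_sub hμ hν
  exact ⟨hi.const_mul _, by rw [integral_const_mul, he', he]; simp⟩

/-- Concentrating successively on finitely many disjoint intervals has the same effect on a
riskmetric as replacing the distortion function by its chords. -/
lemma exists_conc {M : Set (Measure ℝ)} (hM : M ⊆ finiteMean) (J : Finset (ℝ × ℝ)) :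
    IsFamily (J : Set (ℝ × ℝ)) → (∀ p ∈ J, ∀ μ ∈ M, conc (levels p) μ ∈ M) → ∀ μ ∈ M,
      ∃ ν ∈ M, ∫ x, x ∂ν = ∫ x, x ∂μ ∧ ∀ φ : ℝ → ℝ,
        Integrable (fun x => φ (ν.real (Ioi x)) - chordal J φ (μ.real (Ioi x))) volume ∧
        ∫ x, (φ (ν.real (Ioi x)) - chordal J φ (μ.real (Ioi x))) = 0 := by
  induction J using Finset.induction_on with
  | empty =>
    intro _ _ μ hμ
    exact ⟨μ, hμ, rfl, fun φ => by simp [chordal]⟩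
  | insert p J hpJ ih =>
    intro hJ hc μ hμ
    obtain ⟨ν, hν, he, hφ⟩ := ih (hJ.mono (by simp))
      (fun q hq => hc q (Finset.mem_insert_of_mem hq)) μ hμ
    have hpm : p ∈ ((insert p J : Finset (ℝ × ℝ)) : Set (ℝ × ℝ)) := by simp
    have h0 := hJ.nonneg p hpm
    have h := hJ.lt p hpm
    have h1 := hJ.le_one p hpm
    refine ⟨conc (levels p) ν, hc p (Finset.mem_insert_self p J) ν hν,
      (conc_mem_finiteMean (hM hν) h0 h h1).2.trans he, fun φ => ?_⟩
    obtain ⟨i1, e1⟩ := integrable_sub_chordal_conc (hM hν) h0 h h1 φ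
    -- The induction hypothesis is needed for the modified function; this is why the claim
    -- quantifies over all $\varphi$ after the choice of $\nu$.
    obtain ⟨i2, e2⟩ := hφ (chordal {p} φ)
    rw [chordal_insert hpJ hJ] at i2 e2
    have : (fun x => φ ((conc (levels p) ν).real (Ioi x)) -
        chordal (insert p J) φ (μ.real (Ioi x))) = fun x =>
        (φ ((conc (levels p) ν).real (Ioi x)) - chordal {p} φ (ν.real (Ioi x))) +
          (chordal {p} φ (ν.real (Ioi x)) - chordal (insert p J) φ (μ.real (Ioi x))) := by
      funext x; ring
    rw [this]
    exact ⟨i1.add i2, by rw [integral_add i1 i2, e1, e2, add_zero]⟩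

/-! ### Concave functions on `[0,1]` -/

lemma boundedVariationOn_add {f g : ℝ → ℝ} {s : Set ℝ} (hf : BoundedVariationOn f s)
    (hg : BoundedVariationOn g s) : BoundedVariationOn (fun x => f x + g x) s := by
  refine ne_top_of_le_ne_top (ENNReal.add_ne_top.2 ⟨hf, hg⟩) ?_
  refine iSup_le fun p => ?_
  refine le_trans ?_ (add_le_add (eVariationOn.sum_le (n := p.1) p.2.2.1 p.2.2.2)
    (eVariationOn.sum_le (n := p.1) p.2.2.1 p.2.2.2))
  rw [← Finset.sum_add_distrib]
  exact Finset.sum_le_sum fun i _ => edist_add_add_le _ _ _ _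

lemma boundedVariationOn_neg {f : ℝ → ℝ} {s : Set ℝ} (hf : BoundedVariationOn f s) :
    BoundedVariationOn (fun x => -f x) s := by
  refine ne_top_of_le_ne_top hf (iSup_le fun p => ?_)
  simp only [edist_neg_neg]
  exact eVariationOn.sum_le p.2.2.1 p.2.2.2

lemma concave_three {g : ℝ → ℝ} {s : Set ℝ} (hg : ConcaveOn ℝ s g) {x y z : ℝ}
    (hx : x ∈ s) (hz : z ∈ s) (hxy : x ≤ y) (hyz : y ≤ z) :
    (z - y) * g x + (y - x) * g z ≤ (z - x) * g y := by
  rcases hxy.eq_or_lt with rfl | hxy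
  · simp
  rcases hyz.eq_or_lt with rfl | hyz
  · simp
  have := hg.slope_anti_adjacent hx hz hxy hyz
  rw [div_le_div_iff₀ (by linarith) (by linarith)] at this
  linarith

lemma continuousAt_of_concaveOn {f : ℝ → ℝ} (hf : ConcaveOn ℝ (Icc 0 1) f) {t : ℝ}
    (ht : t ∈ Ioo (0:ℝ) 1) : ContinuousAt f t := by
  have := hf.continuousOn_interior
  rw [interior_Icc] at this
  exact this.continuousAt (Ioo_mem_nhds ht.1 ht.2)

/-- After subtraction of a supporting line at $1/2$ the function has its maximum there, so it
increases before and decreases after; jumps at $0$ and $1$ do no harm. Consequently every concave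
majorant that vanishes at $0$ is a competitor in the definition of the envelope. -/
lemma boundedVariationOn_of_concaveOn {f : ℝ → ℝ} (hf : ConcaveOn ℝ (Icc 0 1) f) :
    BoundedVariationOn f (Icc 0 1) := by
  have hc : ConvexOn ℝ (Icc 0 1) (-f) := hf.neg
  have hm : (1 / 2 : ℝ) ∈ interior (Icc (0:ℝ) 1) := by rw [interior_Icc]; norm_num
  have hm' : (1 / 2 : ℝ) ∈ Icc (0:ℝ) 1 := interior_subset hm
  set κ := derivWithin (-f) (Ioi (1 / 2)) (1 / 2)
  set F : ℝ → ℝ := fun t => f t + κ * t with hF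
  have top : ∀ t ∈ Icc (0:ℝ) 1, F t ≤ F (1 / 2) := by
    intro t ht
    rcases lt_trichotomy t (1 / 2) with h | h | h
    · have h1 := hc.slope_le_leftDeriv_of_mem_interior ht hm h
      have h2 := hc.leftDeriv_le_rightDeriv_of_mem_interior hm
      rw [slope_def_field] at h1
      have h3 := h1.trans h2
      rw [div_le_iff₀ (by linarith)] at h3
      simp only [Pi.neg_apply] at h3
      simp only [hF]; linarith
    · rw [h]
    · have h1 := hc.rightDeriv_le_slope_of_mem_interior hm ht h
      rw [slope_def_field, le_div_iff₀ (by linarith)] at h1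
      simp only [Pi.neg_apply] at h1
      simp only [hF]; linarith
  have hFc : ConcaveOn ℝ (Icc 0 1) F := by
    refine hf.add ⟨convex_Icc 0 1, fun x _ y _ a b _ _ _ => ?_⟩
    simp only [smul_eq_mul]; apply le_of_eq; ring
  have mono : MonotoneOn F (Icc 0 (1 / 2)) := by
    intro s hs t ht hst
    rcases hs.2.eq_or_lt with h | h
    · have : t = s := le_antisymm (ht.2.trans h.ge) hst
      rw [this]
    have h0 : s ∈ Icc (0:ℝ) 1 := ⟨hs.1, by linarith [hs.2]⟩
    have h1 := concave_three hFc h0 hm' hst ht.2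
    have h2 := top s h0
    have h3 : (1 / 2 - s) * F s ≤ (1 / 2 - s) * F t := by nlinarith
    exact le_of_mul_le_mul_left h3 (by linarith)
  have anti : AntitoneOn F (Icc (1 / 2) 1) := by
    intro s hs t ht hst
    rcases ht.1.eq_or_lt with h | h
    · have : t = s := le_antisymm (h.symm.le.trans hs.1) hst
      rw [this]
    have h0 : t ∈ Icc (0:ℝ) 1 := ⟨by linarith [ht.1], ht.2⟩
    have h1 := concave_three hFc hm' h0 hs.1 hst
    have h2 := top t h0
    have h3 : (t - 1 / 2) * F t ≤ (t - 1 / 2) * F s := by nlinarith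
    exact le_of_mul_le_mul_left h3 (by linarith)
  have b1 : BoundedVariationOn F (Icc 0 (1 / 2)) := by
    have := mono.locallyBoundedVariationOn 0 (1 / 2) (by norm_num) (by norm_num)
    rwa [inter_self] at this
  have b2 : BoundedVariationOn F (Icc (1 / 2) 1) := by
    have h : MonotoneOn (fun x => -F x) (Icc (1 / 2) 1) := anti.neg
    have := h.locallyBoundedVariationOn (1 / 2) 1 (by norm_num) (by norm_num)
    rw [inter_self] at this
    simpa using boundedVariationOn_neg this
  have b3 : BoundedVariationOn F (Icc 0 1) := by
    have := eVariationOn.Icc_add_Icc F (s := univ) (a := 0) (b := 1 / 2) (c := 1) (by norm_num)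
      (by norm_num) (mem_univ _)
    simp only [univ_inter] at this
    rw [BoundedVariationOn, ← this]
    exact ENNReal.add_ne_top.2 ⟨b1, b2⟩
  have b4 : BoundedVariationOn (fun t => -κ * t) (Icc 0 1) := by
    have h : LipschitzWith (Real.nnabs (-κ)) (fun t : ℝ => -κ * t) := by
      refine LipschitzWith.of_dist_le_mul fun x y => ?_
      rw [Real.dist_eq, Real.dist_eq, ← mul_sub, abs_mul, Real.coe_nnabs]
    have := h.locallyBoundedVariationOn (Icc 0 1) 0 1 (by norm_num) (by norm_num)
    rwa [inter_self] at this
  have := boundedVariationOn_add b3 b4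
  convert this using 2
  simp only [hF]; ring

/-! ### The concave envelope -/

lemma IsDistortion.exists_bound {h : ℝ → ℝ} (hh : IsDistortion h) :
    ∃ K : ℝ, 0 ≤ K ∧ ∀ t ∈ Icc (0:ℝ) 1, h t ≤ K := by
  refine ⟨(eVariationOn h (Icc 0 1)).toReal, ENNReal.toReal_nonneg, fun t ht => ?_⟩
  have := hh.bv.sub_le ht (left_mem_Icc.2 zero_le_one)
  rwa [hh.zero, sub_zero] at this

/-- A constant upper bound on $(0,1)$, lowered to the values of $h$ at the two ends. It makes the
infimum in `concaveEnv` one over a nonempty set and pins the envelope at $0$ and $1$. -/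
lemma IsDistortion.exists_competitor {h : ℝ → ℝ} (hh : IsDistortion h) :
    ∃ g : ℝ → ℝ, IsDistortion g ∧ ConcaveOn ℝ (Icc 0 1) g ∧
      (∀ s ∈ Icc (0 : ℝ) 1, h s ≤ g s) ∧ g 1 = h 1 := by
  obtain ⟨K, hK, hb⟩ := hh.exists_bound
  set g : ℝ → ℝ := fun t => if t ≤ 0 then 0 else if 1 ≤ t then h 1 else K with hg
  have h1 : h 1 ≤ K := hb 1 (right_mem_Icc.2 zero_le_one)
  have gK : ∀ t, g t ≤ K := by intro t; simp only [hg]; split_ifs <;> linarith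
  have g0 : g 0 = 0 := by simp [hg]
  have g1 : g 1 = h 1 := by simp [hg]
  have hc : ConcaveOn ℝ (Icc 0 1) g := by
    refine ⟨convex_Icc 0 1, fun x hx y hy a b ha hb' hab => ?_⟩
    simp only [smul_eq_mul]
    by_cases z0 : a * x + b * y ≤ 0
    · have e1 : 0 ≤ a * x := mul_nonneg ha hx.1
      have e2 : 0 ≤ b * y := mul_nonneg hb' hy.1
      have c1 : a * g x = 0 := by
        rcases mul_eq_zero.1 (show a * x = 0 by linarith) with h | h
        · simp [h]
        · simp [h, g0]
      have c2 : b * g y = 0 := by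
        rcases mul_eq_zero.1 (show b * y = 0 by linarith) with h | h
        · simp [h]
        · simp [h, g0]
      have : g (a * x + b * y) = 0 := by simp only [hg]; rw [if_pos z0]
      linarith
    · by_cases z1 : 1 ≤ a * x + b * y
      · have e1 : 0 ≤ a * (1 - x) := mul_nonneg ha (by linarith [hx.2])
        have e2 : 0 ≤ b * (1 - y) := mul_nonneg hb' (by linarith [hy.2])
        have c1 : a * g x = a * h 1 := by
          rcases mul_eq_zero.1 (show a * (1 - x) = 0 by nlinarith) with h | h
          · simp [h]
          · rw [show x = 1 by linarith, g1]
        have c2 : b * g y = b * h 1 := by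
          rcases mul_eq_zero.1 (show b * (1 - y) = 0 by nlinarith) with h | h
          · simp [h]
          · rw [show y = 1 by linarith, g1]
        have : g (a * x + b * y) = h 1 := by simp only [hg]; rw [if_neg z0, if_pos z1]
        rw [this, c1, c2, ← add_mul, hab, one_mul]
      · have : g (a * x + b * y) = K := by simp only [hg]; rw [if_neg z0, if_neg z1]
        rw [this]
        have := mul_le_mul_of_nonneg_left (gK x) ha
        have := mul_le_mul_of_nonneg_left (gK y) hb'
        have : a * K + b * K = K := by rw [← add_mul, hab, one_mul]
        linarith
  refine ⟨g, ⟨boundedVariationOn_of_concaveOn hc, g0⟩, hc, fun s hs => ?_, g1⟩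
  simp only [hg]
  split_ifs with z0 z1
  · rw [le_antisymm z0 hs.1, hh.zero]
  · rw [le_antisymm hs.2 z1]
  · exact hb s hs

section Envelope

variable {h : ℝ → ℝ}

lemma le_concaveEnv (hh : IsDistortion h) {t : ℝ} (ht : t ∈ Icc (0:ℝ) 1) :
    h t ≤ concaveEnv h t := by
  obtain ⟨g, h1, h2, h3, -⟩ := hh.exists_competitor
  refine le_csInf ⟨g t, g, h1, h2, h3, rfl⟩ ?_
  rintro y ⟨g, -, -, h3, rfl⟩
  exact h3 t ht

lemma concaveEnv_le_of_isDistortion {g : ℝ → ℝ} (hg : IsDistortion g)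
    (hc : ConcaveOn ℝ (Icc 0 1) g) (hle : ∀ s ∈ Icc (0 : ℝ) 1, h s ≤ g s) {t : ℝ}
    (ht : t ∈ Icc (0:ℝ) 1) : concaveEnv h t ≤ g t := by
  refine csInf_le ⟨h t, ?_⟩ ⟨g, hg, hc, hle, rfl⟩
  rintro y ⟨g, -, -, h3, rfl⟩
  exact h3 t ht

lemma concaveEnv_zero (hh : IsDistortion h) : concaveEnv h 0 = 0 := by
  obtain ⟨g, h1, h2, h3, -⟩ := hh.exists_competitor
  have h0 : (0:ℝ) ∈ Icc (0:ℝ) 1 := left_mem_Icc.2 zero_le_one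
  refine le_antisymm ?_ ?_
  · exact (concaveEnv_le_of_isDistortion h1 h2 h3 h0).trans h1.zero.le
  · have := le_concaveEnv hh h0
    rwa [hh.zero] at this

lemma concaveEnv_one (hh : IsDistortion h) : concaveEnv h 1 = h 1 := by
  obtain ⟨g, h1, h2, h3, h4⟩ := hh.exists_competitor
  have h0 : (1:ℝ) ∈ Icc (0:ℝ) 1 := right_mem_Icc.2 zero_le_one
  refine le_antisymm ?_ (le_concaveEnv hh h0)
  rw [← h4]; exact concaveEnv_le_of_isDistortion h1 h2 h3 h0

lemma concaveOn_concaveEnv (hh : IsDistortion h) : ConcaveOn ℝ (Icc 0 1) (concaveEnv h) := by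
  refine ⟨convex_Icc 0 1, fun x hx y hy a b ha hb hab => ?_⟩
  obtain ⟨g, h1, h2, h3, -⟩ := hh.exists_competitor
  refine le_csInf ⟨_, g, h1, h2, h3, rfl⟩ ?_
  rintro _ ⟨g, h1, h2, h3, rfl⟩
  refine le_trans ?_ (h2.2 hx hy ha hb hab)
  simp only [smul_eq_mul]
  exact add_le_add
    (mul_le_mul_of_nonneg_left (concaveEnv_le_of_isDistortion h1 h2 h3 hx) ha)
    (mul_le_mul_of_nonneg_left (concaveEnv_le_of_isDistortion h1 h2 h3 hy) hb)

/-! ### The envelope after subtraction of the linear part -/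

lemma concaveOn_linear (c : ℝ) : ConcaveOn ℝ (Icc (0:ℝ) 1) fun t => c * t := by
  refine ⟨convex_Icc 0 1, fun x _ y _ a b _ _ _ => ?_⟩
  simp only [smul_eq_mul]; apply le_of_eq; ring

lemma concaveOn_tilt (hh : IsDistortion h) : ConcaveOn ℝ (Icc 0 1) (tilt (concaveEnv h)) := by
  refine ConcaveOn.congr ((concaveOn_concaveEnv hh).add (concaveOn_linear
    (-concaveEnv h 1))) fun t ht => ?_
  rw [tilt_of_mem _ ht]
  simp only [Pi.add_apply]; ring

lemma tilt_le_tilt_concaveEnv (hh : IsDistortion h) (t : ℝ) :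
    tilt h t ≤ tilt (concaveEnv h) t := by
  by_cases ht : t ∈ Icc (0:ℝ) 1
  · rw [tilt_of_mem _ ht, tilt_of_mem _ ht, concaveEnv_one hh]
    linarith [le_concaveEnv hh ht]
  · rw [tilt, tilt, indicator_of_notMem ht, indicator_of_notMem ht]

lemma tilt_zero (hh : IsDistortion h) : tilt h 0 = 0 := by
  rw [tilt_of_mem h (left_mem_Icc.2 zero_le_one), hh.zero]; ring

lemma tilt_one (h : ℝ → ℝ) : tilt h 1 = 0 := by
  rw [tilt_of_mem h (right_mem_Icc.2 zero_le_one)]; ring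

lemma isDistortion_concaveEnv (hh : IsDistortion h) : IsDistortion (concaveEnv h) :=
  ⟨boundedVariationOn_of_concaveOn (concaveOn_concaveEnv hh), concaveEnv_zero hh⟩

/-- A concave function that vanishes at both ends lies above the zero chord. -/
lemma tilt_concaveEnv_nonneg (hh : IsDistortion h) (t : ℝ) : 0 ≤ tilt (concaveEnv h) t := by
  by_cases ht : t ∈ Icc (0:ℝ) 1
  · have := concave_three (concaveOn_tilt hh) (left_mem_Icc.2 zero_le_one)
      (right_mem_Icc.2 zero_le_one) ht.1 ht.2
    rw [tilt_one, tilt_zero (isDistortion_concaveEnv hh)] at this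
    linarith
  · rw [tilt, indicator_of_notMem ht]

/-- The envelope is the least concave majorant. -/
lemma tilt_concaveEnv_le {w : ℝ → ℝ} (hw : ConcaveOn ℝ (Icc 0 1) w) (hw0 : w 0 = 0)
    (hh : IsDistortion h) (hle : ∀ t ∈ Icc (0:ℝ) 1, tilt h t ≤ w t) {t : ℝ}
    (ht : t ∈ Icc (0:ℝ) 1) : tilt (concaveEnv h) t ≤ w t := by
  have hc : ConcaveOn ℝ (Icc 0 1) (fun t => w t + h 1 * t) := hw.add (concaveOn_linear (h 1))
  have := concaveEnv_le_of_isDistortion (h := h)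
    ⟨boundedVariationOn_of_concaveOn hc, by simp [hw0]⟩ hc (fun s hs => ?_) ht
  · rw [tilt_of_mem _ ht, concaveEnv_one hh]; linarith
  · have := hle s hs
    rw [tilt_of_mem _ hs] at this; linarith

lemma measurable_indicator_of_monotoneOn {f : ℝ → ℝ} {s : Set ℝ} [OrdConnected s]
    (hs : MeasurableSet s) (hf : MonotoneOn f s) : Measurable (s.indicator f) := by
  refine measurable_of_restrict_of_restrict_compl hs ?_ ?_
  · have : s.domRestrict (s.indicator f) = s.domRestrict f :=
      funext fun x => indicator_of_mem x.2 f
    rw [this]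
    exact Monotone.measurable fun x y hxy => hf x.2 y.2 hxy
  · have : sᶜ.domRestrict (s.indicator f) = fun _ => 0 :=
      funext fun x => indicator_of_notMem x.2 f
    rw [this]
    exact measurable_const

/-- Bounded variation gives a difference of monotone functions on $[0,1]$. The cut-off in `tilt` is
what yields measurability on all of $\mathbb R$, since `h` is arbitrary outside. -/
lemma measurable_tilt (hh : IsDistortion h) : Measurable (tilt h) := by
  obtain ⟨p, q, hp, hq, rfl⟩ := hh.bv.locallyBoundedVariationOn.exists_monotoneOn_sub_monotoneOn
  have : tilt (p - q) = fun t => (Icc (0:ℝ) 1).indicator p t - (Icc (0:ℝ) 1).indicator q t -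
      (Icc (0:ℝ) 1).indicator (fun t => (p - q) 1 * t) t := by
    funext t
    by_cases ht : t ∈ Icc (0:ℝ) 1
    · rw [tilt_of_mem _ ht, indicator_of_mem ht, indicator_of_mem ht, indicator_of_mem ht]; rfl
    · rw [tilt, indicator_of_notMem ht, indicator_of_notMem ht, indicator_of_notMem ht,
        indicator_of_notMem ht]; ring
  rw [this]
  exact ((measurable_indicator_of_monotoneOn measurableSet_Icc hp).sub
    (measurable_indicator_of_monotoneOn measurableSet_Icc hq)).sub
    ((measurable_const.mul measurable_id).indicator measurableSet_Icc)

end Envelope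

/-! ### Chords of concave functions -/

lemma chord_eq (φ : ℝ → ℝ) {p : ℝ × ℝ} (h : p.1 < p.2) (t : ℝ) :
    chord φ p t = ((p.2 - t) * φ p.1 + (t - p.1) * φ p.2) / (p.2 - p.1) := by
  have : p.2 - p.1 ≠ 0 := by linarith
  rw [chord]; field_simp; ring

lemma chord_mono {φ ψ : ℝ → ℝ} {p : ℝ × ℝ} (h : p.1 < p.2) (h1 : φ p.1 ≤ ψ p.1)
    (h2 : φ p.2 ≤ ψ p.2) {t : ℝ} (ht : t ∈ Icc p.1 p.2) : chord φ p t ≤ chord ψ p t := by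
  rw [chord_eq φ h, chord_eq ψ h]
  have := mul_le_mul_of_nonneg_left h1 (sub_nonneg.2 ht.2)
  have := mul_le_mul_of_nonneg_left h2 (sub_nonneg.2 ht.1)
  exact div_le_div_of_nonneg_right (by linarith) (by linarith)

lemma chord_const_mul (c : ℝ) (φ : ℝ → ℝ) (p : ℝ × ℝ) (t : ℝ) :
    chord (fun s => c * φ s) p t = c * chord φ p t := by
  simp only [chord]; ring

lemma chord_chord (φ : ℝ → ℝ) (p : ℝ × ℝ) {q : ℝ × ℝ} (h : q.1 < q.2) (t : ℝ) :
    chord (chord φ p) q t = chord φ p t := by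
  rw [chord_eq _ h, chord, chord, chord]
  have : q.2 - q.1 ≠ 0 := by linarith
  rw [div_eq_iff this]; ring

lemma chord_nonneg {φ : ℝ → ℝ} {p : ℝ × ℝ} (h : p.1 < p.2) (h1 : 0 ≤ φ p.1)
    (h2 : 0 ≤ φ p.2) {t : ℝ} (ht : t ∈ Icc p.1 p.2) : 0 ≤ chord φ p t := by
  rw [chord_eq φ h]
  have := mul_nonneg (sub_nonneg.2 ht.2) h1
  have := mul_nonneg (sub_nonneg.2 ht.1) h2
  exact div_nonneg (by linarith) (by linarith)

lemma chord_le {g : ℝ → ℝ} {s : Set ℝ} (hg : ConcaveOn ℝ s g) {p : ℝ × ℝ} (h : p.1 < p.2)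
    (h1 : p.1 ∈ s) (h2 : p.2 ∈ s) {t : ℝ} (ht : t ∈ Icc p.1 p.2) : chord g p t ≤ g t := by
  rw [chord_eq g h, div_le_iff₀ (by linarith)]
  linarith [concave_three hg h1 h2 ht.1 ht.2]

lemma le_chord {g : ℝ → ℝ} {s : Set ℝ} (hg : ConcaveOn ℝ s g) {p : ℝ × ℝ} (h : p.1 < p.2)
    (h1 : p.1 ∈ s) (h2 : p.2 ∈ s) {t : ℝ} (hts : t ∈ s) (ht : t ∉ Ioo p.1 p.2) :
    g t ≤ chord g p t := by
  rw [chord_eq g h, le_div_iff₀ (by linarith)]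
  rcases le_or_gt t p.1 with h3 | h3
  · linarith [concave_three hg hts h2 h3 h.le]
  · have h4 : p.2 ≤ t := by by_contra h5; exact ht ⟨h3, not_le.1 h5⟩
    linarith [concave_three hg h1 hts h.le h4]

lemma concaveOn_chord (φ : ℝ → ℝ) (p : ℝ × ℝ) : ConcaveOn ℝ (Icc (0:ℝ) 1) (chord φ p) := by
  refine ⟨convex_Icc 0 1, fun x _ y _ a b _ _ hab => ?_⟩
  simp only [smul_eq_mul, chord]
  obtain rfl : b = 1 - a := by linarith
  apply le_of_eq; ring

lemma IsFamily.mem_Icc {J : Set (ℝ × ℝ)} (hJ : IsFamily J) {p : ℝ × ℝ} (hp : p ∈ J) :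
    p.1 ∈ Icc (0:ℝ) 1 ∧ p.2 ∈ Icc (0:ℝ) 1 := by
  have h0 := hJ.nonneg p hp
  have h := hJ.lt p hp
  have h1 := hJ.le_one p hp
  exact ⟨⟨h0, by linarith⟩, ⟨by linarith, h1⟩⟩

lemma chordal_le {J : Finset (ℝ × ℝ)} (hJ : IsFamily (J : Set (ℝ × ℝ))) {g : ℝ → ℝ}
    (hg : ConcaveOn ℝ (Icc 0 1) g) (t : ℝ) : chordal J g t ≤ g t := by
  by_cases h : ∃ p ∈ J, t ∈ Ioo p.1 p.2
  · obtain ⟨p, hp, ht⟩ := h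
    rw [chordal_of_mem hJ g hp ht]
    exact chord_le hg (hJ.lt p hp) (hJ.mem_Icc hp).1 (hJ.mem_Icc hp).2 (Ioo_subset_Icc_self ht)
  · push Not at h
    rw [chordal_of_notMem g h]

lemma chordal_nonneg {J : Finset (ℝ × ℝ)} (hJ : IsFamily (J : Set (ℝ × ℝ))) {g : ℝ → ℝ}
    (hg : ∀ t, 0 ≤ g t) (t : ℝ) : 0 ≤ chordal J g t := by
  by_cases h : ∃ p ∈ J, t ∈ Ioo p.1 p.2
  · obtain ⟨p, hp, ht⟩ := h
    rw [chordal_of_mem hJ g hp ht]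
    exact chord_nonneg (hJ.lt p hp) (hg _) (hg _) (Ioo_subset_Icc_self ht)
  · push Not at h
    rw [chordal_of_notMem g h]; exact hg t

/-- Replacing a concave function by its chords gives a concave function. -/
lemma concaveOn_chordal (J : Finset (ℝ × ℝ)) : IsFamily (J : Set (ℝ × ℝ)) →
    ∀ g : ℝ → ℝ, ConcaveOn ℝ (Icc 0 1) g → ConcaveOn ℝ (Icc 0 1) (chordal J g) := by
  induction J using Finset.induction_on with
  | empty =>
    intro _ g hg
    refine hg.congr fun t _ => ?_
    simp [chordal]
  | insert p J hpJ ih =>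
    intro hJ g hg
    rw [← chordal_insert hpJ hJ]
    refine ih (hJ.mono (by simp)) _ ?_
    have hp : p ∈ ((insert p J : Finset (ℝ × ℝ)) : Set (ℝ × ℝ)) := by simp
    have hp' : IsFamily (({p} : Finset (ℝ × ℝ)) : Set (ℝ × ℝ)) := hJ.mono (by simp)
    have hlt := hJ.lt p hp
    -- A concave function lies above its chord between the endpoints and below the extended line
    -- outside, so replacement on one interval is the minimum with a line.
    refine ConcaveOn.congr (hg.inf (concaveOn_chord g p)) fun t ht => ?_
    simp only [Pi.inf_apply]
    by_cases h : t ∈ Ioo p.1 p.2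
    · rw [chordal_of_mem hp' g (Finset.mem_singleton_self p) h]
      exact inf_eq_right.2 (chord_le hg hlt (hJ.mem_Icc hp).1 (hJ.mem_Icc hp).2
        (Ioo_subset_Icc_self h))
    · rw [chordal_of_notMem g (by simpa using h)]
      exact inf_eq_left.2 (le_chord hg hlt (hJ.mem_Icc hp).1 (hJ.mem_Icc hp).2 ht h)

/-! ### Partitions -/

/-- The intervals between neighbouring points of a finite set. -/
def pieces (T : Finset ℝ) : Finset (ℝ × ℝ) :=
  (T ×ˢ T).filter fun p => p.1 < p.2 ∧ ∀ s ∈ T, ¬ (p.1 < s ∧ s < p.2)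

lemma mem_pieces {T : Finset ℝ} {p : ℝ × ℝ} : p ∈ pieces T ↔
    p.1 ∈ T ∧ p.2 ∈ T ∧ p.1 < p.2 ∧ ∀ s ∈ T, ¬ (p.1 < s ∧ s < p.2) := by
  rw [pieces, Finset.mem_filter, Finset.mem_product, and_assoc]

lemma isFamily_pieces {T : Finset ℝ} (hT : ∀ t ∈ T, t ∈ Icc (0:ℝ) 1) :
    IsFamily (pieces T : Set (ℝ × ℝ)) := by
  refine ⟨fun p hp => (hT _ (mem_pieces.1 hp).1).1, fun p hp => (mem_pieces.1 hp).2.2.1,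
    fun p hp => (hT _ (mem_pieces.1 hp).2.1).2, fun p hp q hq t h1 h2 => ?_⟩
  obtain ⟨a1, a2, -, a4⟩ := mem_pieces.1 hp
  obtain ⟨b1, b2, -, b4⟩ := mem_pieces.1 hq
  have c1 := a4 _ b1
  have c2 := a4 _ b2
  have c3 := b4 _ a1
  have c4 := b4 _ a2
  have d1 := h1.1
  have d2 := h1.2
  have d3 := h2.1
  have d4 := h2.2
  refine Prod.ext (le_antisymm ?_ ?_) (le_antisymm ?_ ?_)
  · by_contra h; push Not at h; exact c3 ⟨h, by linarith⟩
  · by_contra h; push Not at h; exact c1 ⟨h, by linarith⟩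
  · by_contra h; push Not at h; exact c2 ⟨by linarith, h⟩
  · by_contra h; push Not at h; exact c4 ⟨by linarith, h⟩

lemma notMem_pieces {T : Finset ℝ} {t : ℝ} (ht : t ∈ T) : ∀ p ∈ pieces T, t ∉ Ioo p.1 p.2 :=
  fun _ hp h => (mem_pieces.1 hp).2.2.2 t ht h

lemma exists_piece {T : Finset ℝ} (h0 : (0:ℝ) ∈ T) (h1 : (1:ℝ) ∈ T) {t : ℝ}
    (ht : t ∈ Icc (0:ℝ) 1) (htT : t ∉ T) : ∃ p ∈ pieces T, t ∈ Ioo p.1 p.2 := by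
  have t0 : 0 < t := lt_of_le_of_ne ht.1 (by rintro rfl; exact htT h0)
  have t1 : t < 1 := lt_of_le_of_ne ht.2 (by rintro rfl; exact htT h1)
  have n1 : (T.filter (· < t)).Nonempty := ⟨0, Finset.mem_filter.2 ⟨h0, t0⟩⟩
  have n2 : (T.filter (t < ·)).Nonempty := ⟨1, Finset.mem_filter.2 ⟨h1, t1⟩⟩
  obtain ⟨a1, a2⟩ := Finset.mem_filter.1 (Finset.max'_mem _ n1)
  obtain ⟨b1, b2⟩ := Finset.mem_filter.1 (Finset.min'_mem _ n2)
  refine ⟨(_, _), mem_pieces.2 ⟨a1, b1, a2.trans b2, ?_⟩, a2, b2⟩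
  rintro s hs ⟨c1, c2⟩
  rcases lt_trichotomy s t with h | rfl | h
  · exact absurd c1 (not_lt.2 (Finset.le_max' _ _ (Finset.mem_filter.2 ⟨hs, h⟩)))
  · exact htT hs
  · exact absurd c2 (not_lt.2 (Finset.min'_le _ _ (Finset.mem_filter.2 ⟨hs, h⟩)))

/-- A fine piece lies inside a coarse one. The coarse chord is its own chord over the fine piece,
and its values at the ends are below those of the concave function. -/
lemma chordal_pieces_mono {T T' : Finset ℝ} (hT' : ∀ t ∈ T', t ∈ Icc (0:ℝ) 1) (h0 : (0:ℝ) ∈ T)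
    (h1 : (1:ℝ) ∈ T) (hTT : T ⊆ T') {g : ℝ → ℝ} (hg : ConcaveOn ℝ (Icc 0 1) g) {t : ℝ}
    (ht : t ∈ Icc (0:ℝ) 1) : chordal (pieces T) g t ≤ chordal (pieces T') g t := by
  have hT : ∀ t ∈ T, t ∈ Icc (0:ℝ) 1 := fun t ht => hT' t (hTT ht)
  have F := isFamily_pieces hT
  have F' := isFamily_pieces hT'
  by_cases htT' : t ∈ T'
  · rw [chordal_of_notMem g (notMem_pieces htT')]
    exact chordal_le F hg t
  · obtain ⟨q, hq, htq⟩ := exists_piece (hTT h0) (hTT h1) ht htT'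
    obtain ⟨p, hp, htp⟩ := exists_piece h0 h1 ht fun h => htT' (hTT h)
    rw [chordal_of_mem F g hp htp, chordal_of_mem F' g hq htq]
    obtain ⟨a1, a2, a3, -⟩ := mem_pieces.1 hp
    obtain ⟨b1, b2, b3, b4⟩ := mem_pieces.1 hq
    have c1 : p.1 ≤ q.1 := by
      by_contra h; push Not at h; exact b4 _ (hTT a1) ⟨h, htp.1.trans htq.2⟩
    have c2 : q.2 ≤ p.2 := by
      by_contra h; push Not at h; exact b4 _ (hTT a2) ⟨htq.1.trans htp.2, h⟩
    rw [← chord_chord g p b3]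
    refine chord_mono b3 ?_ ?_ (Ioo_subset_Icc_self htq)
    · exact chord_le hg a3 (hT _ a1) (hT _ a2) ⟨c1, by linarith⟩
    · exact chord_le hg a3 (hT _ a1) (hT _ a2) ⟨by linarith, c2⟩

/-- Chords between points where the distortion function nearly attains its envelope approximate the
envelope. -/
lemma exists_approx {h : ℝ → ℝ} (hh : IsDistortion h) {ε : ℝ} (hε : 0 < ε) (hε1 : ε < 1) :
    ∃ J : ℕ → Finset (ℝ × ℝ), (∀ n, IsFamily (J n : Set (ℝ × ℝ))) ∧
      (∀ n, ∀ t ∈ Icc (0:ℝ) 1,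
        (1 - ε) * chordal (J n) (tilt (concaveEnv h)) t ≤ chordal (J n) (tilt h) t) ∧
      (∀ t ∈ Icc (0:ℝ) 1, Monotone fun n => chordal (J n) (tilt (concaveEnv h)) t) ∧
      ∀ t ∈ Icc (0:ℝ) 1, Filter.Tendsto (fun n => chordal (J n) (tilt (concaveEnv h)) t)
        Filter.atTop (nhds (tilt (concaveEnv h) t)) := by
  set g := tilt (concaveEnv h) with hg
  have gc : ConcaveOn ℝ (Icc 0 1) g := concaveOn_tilt hh
  have gpos : ∀ t, 0 ≤ g t := tilt_concaveEnv_nonneg hh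
  have g0 : g 0 = 0 := tilt_zero (isDistortion_concaveEnv hh)
  have g1 : g 1 = 0 := tilt_one _
  have I0 : (0:ℝ) ∈ Icc (0:ℝ) 1 := left_mem_Icc.2 zero_le_one
  have I1 : (1:ℝ) ∈ Icc (0:ℝ) 1 := right_mem_Icc.2 zero_le_one
  set A : Set ℝ := {t | t ∈ Icc (0:ℝ) 1 ∧ (1 - ε) * g t ≤ tilt h t}
  have A0 : (0:ℝ) ∈ A := ⟨I0, by rw [g0, tilt_zero hh]; simp⟩
  have A1 : (1:ℝ) ∈ A := ⟨I1, by rw [g1, tilt_one]; simp⟩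
  -- A countable dense subset of the near-contact set `A`, so that finite sets of nodes can exhaust
  -- it.
  obtain ⟨B, hBA, hBc, hAB⟩ :=
    (TopologicalSpace.IsSeparable.of_separableSpace A).exists_countable_dense_subset
  have B'c : (insert 0 (insert 1 B)).Countable := (hBc.insert 1).insert 0
  obtain ⟨b, hb⟩ := B'c.exists_eq_range ⟨0, mem_insert _ _⟩
  have hbA : ∀ n, b n ∈ A := by
    intro n
    have : b n ∈ insert 0 (insert 1 B) := hb ▸ mem_range_self n
    rcases this with h | h | h
    · rw [h]; exact A0
    · rw [h]; exact A1
    · exact hBA h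
  set T : ℕ → Finset ℝ := fun n => insert 0 (insert 1 ((Finset.range n).image b)) with hT
  have T0 : ∀ n, (0:ℝ) ∈ T n := fun n => by simp [hT]
  have T1 : ∀ n, (1:ℝ) ∈ T n := fun n => by simp [hT]
  have TA : ∀ n, ∀ t ∈ T n, t ∈ A := by
    intro n t ht
    simp only [hT, Finset.mem_insert, Finset.mem_image] at ht
    rcases ht with rfl | rfl | ⟨k, -, rfl⟩
    · exact A0
    · exact A1
    · exact hbA k
  have TI : ∀ n, ∀ t ∈ T n, t ∈ Icc (0:ℝ) 1 := fun n t ht => (TA n t ht).1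
  have Tm : Monotone T := by
    intro m n hmn
    exact Finset.insert_subset_insert _ (Finset.insert_subset_insert _
      (Finset.image_subset_image (Finset.range_mono hmn)))
  set G : ℕ → ℝ → ℝ := fun n => chordal (pieces (T n)) g
  have F : ∀ n, IsFamily (pieces (T n) : Set (ℝ × ℝ)) := fun n => isFamily_pieces (TI n)
  have Gm : ∀ t ∈ Icc (0:ℝ) 1, Monotone fun n => G n t := fun t ht m n hmn =>
    chordal_pieces_mono (TI n) (T0 m) (T1 m) (Tm hmn) gc ht
  have Gle : ∀ n t, G n t ≤ g t := fun n t => chordal_le (F n) gc t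
  set m : ℝ → ℝ := fun t => ⨆ n, G n t
  have Gbdd : ∀ t, BddAbove (range fun n => G n t) := fun t =>
    ⟨g t, by rintro _ ⟨n, rfl⟩; exact Gle n t⟩
  have Gt : ∀ t ∈ Icc (0:ℝ) 1, Filter.Tendsto (fun n => G n t) Filter.atTop (nhds (m t)) :=
    fun t ht => tendsto_atTop_ciSup (Gm t ht) (Gbdd t)
  have mle : ∀ t, m t ≤ g t := fun t => ciSup_le fun n => Gle n t
  have mpos : ∀ t, 0 ≤ m t := fun t =>
    (chordal_nonneg (F 0) gpos t).trans (le_ciSup (Gbdd t) 0)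
  have mc : ConcaveOn ℝ (Icc 0 1) m := by
    refine ⟨convex_Icc 0 1, fun x hx y hy a c ha hc hac => ?_⟩
    have hz := convex_Icc (0:ℝ) 1 hx hy ha hc hac
    refine le_of_tendsto_of_tendsto' (((Gt x hx).const_smul a).add ((Gt y hy).const_smul c))
      (Gt _ hz) fun n => ?_
    exact (concaveOn_chordal _ (F n) g gc).2 hx hy ha hc hac
  have mB : ∀ n, m (b n) = g (b n) := by
    intro n
    refine le_antisymm (mle _) ?_
    -- The nodes of `T n` are `b 0, …, b (n - 1)` and the two ends, so `b n` first appears in `T (n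
    -- + 1)`.
    have : G (n + 1) (b n) = g (b n) := by
      refine chordal_of_notMem g (notMem_pieces ?_)
      simp only [hT, Finset.mem_insert, Finset.mem_image, Finset.mem_range]
      exact Or.inr (Or.inr ⟨n, by omega, rfl⟩)
    rw [← this]
    exact le_ciSup (Gbdd _) (n + 1)
  -- Both functions are concave, hence continuous inside $(0,1)$, and they agree on a dense subset
  -- of `A`.
  have mA : ∀ t ∈ A, t ∈ Ioo (0:ℝ) 1 → m t = g t := by
    intro t htA ht
    have : (nhdsWithin t B).NeBot := mem_closure_iff_nhdsWithin_neBot.1 (hAB htA)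
    refine tendsto_nhds_unique_of_eventuallyEq
      ((continuousAt_of_concaveOn mc ht).tendsto.mono_left nhdsWithin_le_nhds)
      ((continuousAt_of_concaveOn gc ht).tendsto.mono_left (nhdsWithin_le_nhds (s := B))) ?_
    filter_upwards [self_mem_nhdsWithin] with s hs
    have : s ∈ range b := hb ▸ (mem_insert_of_mem _ (mem_insert_of_mem _ hs))
    obtain ⟨n, rfl⟩ := this
    exact mB n
  have mg : ∀ t ∈ Icc (0:ℝ) 1, m t = g t := by
    intro t ht
    refine le_antisymm (mle t) ?_
    have m0 : m 0 = 0 := le_antisymm ((mle 0).trans g0.le) (mpos 0)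
    -- This mixture majorizes $\tilde h$: on `A` it equals $g$, off `A` already $(1-\varepsilon)g$
    -- exceeds $\tilde h$. Being concave it is at least the envelope $g$, which forces $m\ge g$.
    have wc : ConcaveOn ℝ (Icc 0 1) (fun t => (1 - ε) * g t + ε * m t) :=
      (gc.smul (by linarith : (0:ℝ) ≤ 1 - ε)).add (mc.smul hε.le)
    have := tilt_concaveEnv_le wc (by simp [g0, m0]) hh (fun s hs => ?_) ht
    · rw [← hg] at this
      have h3 : ε * g t ≤ ε * m t := by linarith
      exact le_of_mul_le_mul_left h3 hε
    · have e1 := mul_nonneg (by linarith : (0:ℝ) ≤ 1 - ε) (gpos s)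
      have e2 := mul_nonneg hε.le (mpos s)
      by_cases hsA : s ∈ A
      · rcases hs.1.eq_or_lt with rfl | s0
        · rw [tilt_zero hh]; linarith
        rcases hs.2.eq_or_lt with rfl | s1
        · rw [tilt_one]; linarith
        rw [mA s hsA ⟨s0, s1⟩]
        have := tilt_le_tilt_concaveEnv hh s
        linarith
      · have : tilt h s < (1 - ε) * g s := by
          by_contra hc; exact hsA ⟨hs, not_lt.1 hc⟩
        linarith
  refine ⟨fun n => pieces (T n), F, fun n t ht => ?_, Gm, fun t ht => mg t ht ▸ Gt t ht⟩
  by_cases htT : t ∈ T n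
  · rw [chordal_of_notMem _ (notMem_pieces htT), chordal_of_notMem _ (notMem_pieces htT)]
    exact (TA n t htT).2
  · obtain ⟨p, hp, htp⟩ := exists_piece (T0 n) (T1 n) ht htT
    rw [chordal_of_mem (F n) _ hp htp, chordal_of_mem (F n) _ hp htp, ← chord_const_mul]
    obtain ⟨a1, a2, a3, -⟩ := mem_pieces.1 hp
    exact chord_mono a3 (TA n _ a1).2 (TA n _ a2).2 (Ioo_subset_Icc_self htp)

/-! ### Gaps between the distortion function and its envelope -/

/-- The endpoints of the gaps. -/
def gaps (h : ℝ → ℝ) : Set (ℝ × ℝ) := {p | IsGap h p.1 p.2}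

lemma gapIntervals_eq (h : ℝ → ℝ) : gapIntervals h = levels '' gaps h := by
  ext C
  constructor
  · rintro ⟨a, b, hab, rfl⟩; exact ⟨(a, b), hab, rfl⟩
  · rintro ⟨p, hp, rfl⟩; exact ⟨p.1, p.2, hp, rfl⟩

section Gaps

variable {h : ℝ → ℝ}

/-- The endpoints of a gap are outside the gap set, so two overlapping gaps cannot have different
endpoints. -/
lemma isFamily_gaps (h : ℝ → ℝ) : IsFamily (gaps h) := by
  have sub : ∀ p ∈ gaps h, Icc p.1 p.2 ⊆ Icc 0 1 := by
    rintro p ⟨h1, h2, -⟩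
    rw [← closure_Ioo h1.ne]
    exact closure_minimal (fun t ht => (h2 ht).1) isClosed_Icc
  refine ⟨fun p hp => (sub p hp (left_mem_Icc.2 hp.1.le)).1, fun p hp => hp.1,
    fun p hp => (sub p hp (right_mem_Icc.2 hp.1.le)).2, ?_⟩
  rintro p ⟨-, a2, a3, a4⟩ q ⟨-, b2, b3, b4⟩ t h1 h2
  have d1 := h1.1
  have d2 := h1.2
  have d3 := h2.1
  have d4 := h2.2
  refine Prod.ext (le_antisymm ?_ ?_) (le_antisymm ?_ ?_)
  · by_contra h; push Not at h; exact a3 (b2 ⟨h, by linarith⟩)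
  · by_contra h; push Not at h; exact b3 (a2 ⟨h, by linarith⟩)
  · by_contra h; push Not at h; exact b4 (a2 ⟨by linarith, h⟩)
  · by_contra h; push Not at h; exact a4 (b2 ⟨by linarith, h⟩)

lemma mem_gapSet_iff (hh : IsDistortion h) (hu : EqOn h (uscMod h) (Icc 0 1)) {t : ℝ} :
    t ∈ gapSet h ↔ t ∈ Ioo (0:ℝ) 1 ∧ h t < concaveEnv h t := by
  constructor
  · rintro ⟨ht, hne⟩
    rw [← hu ht] at hne
    refine ⟨⟨lt_of_le_of_ne ht.1 ?_, lt_of_le_of_ne ht.2 ?_⟩,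
      lt_of_le_of_ne (le_concaveEnv hh ht) hne⟩
    · rintro rfl; exact hne (by rw [hh.zero, concaveEnv_zero hh])
    · rintro rfl; exact hne (by rw [concaveEnv_one hh])
  · rintro ⟨ht, hlt⟩
    have ht' := Ioo_subset_Icc_self ht
    exact ⟨ht', by rw [← hu ht']; exact hlt.ne⟩

/-- Upper semicontinuity inside $(0,1)$: bounded variation provides one-sided limits, and $h=\hat h$
puts both of them at or below the value. -/
lemma eventually_lt_of_eqOn_uscMod (hh : IsDistortion h) (hu : EqOn h (uscMod h) (Icc 0 1)) {t : ℝ}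
    (ht : t ∈ Ioo (0:ℝ) 1) {y : ℝ} (hy : h t < y) : ∀ᶠ s in nhds t, h s < y := by
  have hle : Function.rightLim h t ≤ h t ∧ Function.leftLim h t ≤ h t := by
    have := hu (Ioo_subset_Icc_self ht)
    by_cases hj : t ∈ jumpSet h
    · rw [uscMod, if_pos hj] at this
      constructor <;> rw [this]
      · exact (le_max_left _ _).trans (le_max_left _ _)
      · exact (le_max_right _ _).trans (le_max_left _ _)
    · have : ¬ (h t ≠ Function.rightLim h t ∨ h t ≠ Function.leftLim h t) := fun hc => hj ⟨ht, hc⟩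
      push Not at this
      exact ⟨this.1.ge, this.2.ge⟩
  have r : Filter.Tendsto h (nhdsWithin t (Ioi t)) (nhds (Function.rightLim h t)) := by
    obtain ⟨l, hl⟩ := hh.bv.exists_tendsto_right t
    have e : nhdsWithin t (Icc 0 1 ∩ Ioi t) = nhdsWithin t (Ioi t) := by
      rw [inter_comm]
      exact nhdsWithin_inter_of_mem' (nhdsWithin_le_nhds (Icc_mem_nhds ht.1 ht.2))
    rw [e] at hl
    rwa [rightLim_eq_of_tendsto hl]
  have l : Filter.Tendsto h (nhdsWithin t (Iio t)) (nhds (Function.leftLim h t)) := by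
    obtain ⟨l, hl⟩ := hh.bv.exists_tendsto_left t
    have e : nhdsWithin t (Icc 0 1 ∩ Iio t) = nhdsWithin t (Iio t) := by
      rw [inter_comm]
      exact nhdsWithin_inter_of_mem' (nhdsWithin_le_nhds (Icc_mem_nhds ht.1 ht.2))
    rw [e] at hl
    rwa [leftLim_eq_of_tendsto hl]
  have r' := r.eventually (gt_mem_nhds (hle.1.trans_lt hy))
  have l' := l.eventually (gt_mem_nhds (hle.2.trans_lt hy))
  rw [eventually_nhdsWithin_iff] at r' l'
  filter_upwards [r', l'] with s hr hl
  rcases lt_trichotomy s t with h1 | rfl | h1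
  · exact hl h1
  · exact hy
  · exact hr h1

/-- The distance to the envelope is lower semicontinuous inside `(0,1)`. -/
lemma eventually_lt_concaveEnv_sub (hh : IsDistortion h) (hu : EqOn h (uscMod h) (Icc 0 1)) {t : ℝ}
    (ht : t ∈ Ioo (0:ℝ) 1) {y : ℝ} (hy : y < concaveEnv h t - h t) :
    ∀ᶠ s in nhds t, y < concaveEnv h s - h s := by
  obtain ⟨z, hz1, hz2⟩ := exists_between (show h t < concaveEnv h t - y by linarith)
  filter_upwards [eventually_lt_of_eqOn_uscMod hh hu ht hz1,
    (continuousAt_of_concaveOn (concaveOn_concaveEnv hh) ht).tendsto.eventually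
      (lt_mem_nhds (show z + y < concaveEnv h t by linarith))] with s h1 h2
  linarith

lemma isOpen_gapSet (hh : IsDistortion h) (hu : EqOn h (uscMod h) (Icc 0 1)) :
    IsOpen (gapSet h) := by
  rw [isOpen_iff_eventually]
  intro t ht
  obtain ⟨ht, hlt⟩ := (mem_gapSet_iff hh hu).1 ht
  filter_upwards [eventually_lt_concaveEnv_sub hh hu ht (sub_pos.2 hlt),
    Ioo_mem_nhds ht.1 ht.2] with s h1 h2
  exact (mem_gapSet_iff hh hu).2 ⟨h2, by linarith⟩

lemma exists_gap (hh : IsDistortion h) (hu : EqOn h (uscMod h) (Icc 0 1)) {t : ℝ}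
    (ht : t ∈ gapSet h) : ∃ p ∈ gaps h, t ∈ Ioo p.1 p.2 := by
  have hc : IsClosed (gapSet h)ᶜ := (isOpen_gapSet hh hu).isClosed_compl
  have ht0 := ((mem_gapSet_iff hh hu).1 ht).1
  have z0 : (0:ℝ) ∉ gapSet h := fun h0 => lt_irrefl _ ((mem_gapSet_iff hh hu).1 h0).1.1
  have z1 : (1:ℝ) ∉ gapSet h := fun h0 => lt_irrefl _ ((mem_gapSet_iff hh hu).1 h0).1.2
  have bA : BddAbove ((gapSet h)ᶜ ∩ Iic t) := ⟨t, fun s hs => hs.2⟩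
  have bB : BddBelow ((gapSet h)ᶜ ∩ Ici t) := ⟨t, fun s hs => hs.2⟩
  have ha := (hc.inter isClosed_Iic).csSup_mem ⟨0, z0, ht0.1.le⟩ bA
  have hb := (hc.inter isClosed_Ici).csInf_mem ⟨1, z1, ht0.2.le⟩ bB
  -- The ends of the component of `t` are the nearest points of the closed complement on either
  -- side.
  set a := sSup ((gapSet h)ᶜ ∩ Iic t)
  set b := sInf ((gapSet h)ᶜ ∩ Ici t)
  have hat : a < t := lt_of_le_of_ne ha.2 fun e => ha.1 (e ▸ ht)
  have htb : t < b := lt_of_le_of_ne hb.2 fun e => hb.1 (e ▸ ht)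
  refine ⟨(a, b), ⟨hat.trans htb, fun s hs => ?_, ha.1, hb.1⟩, hat, htb⟩
  by_contra hsn
  rcases le_total s t with h1 | h1
  · exact absurd (le_csSup bA ⟨hsn, h1⟩) (not_le.2 hs.1)
  · exact absurd (csInf_le bB ⟨hsn, h1⟩) (not_le.2 hs.2)

lemma tilt_eq_of_notMem_gapSet (hh : IsDistortion h) (hu : EqOn h (uscMod h) (Icc 0 1)) {t : ℝ}
    (ht : t ∈ Icc (0:ℝ) 1) (hg : t ∉ gapSet h) : tilt h t = tilt (concaveEnv h) t := by
  have : uscMod h t = concaveEnv h t := by by_contra hc; exact hg ⟨ht, hc⟩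
  rw [tilt_of_mem _ ht, tilt_of_mem _ ht, concaveEnv_one hh, ← this, ← hu ht]

lemma tilt_eq_of_notMem_gaps (hh : IsDistortion h) (hu : EqOn h (uscMod h) (Icc 0 1)) {t : ℝ}
    (ht : t ∈ Icc (0:ℝ) 1) (hg : ∀ p ∈ gaps h, t ∉ Ioo p.1 p.2) :
    tilt h t = tilt (concaveEnv h) t := by
  refine tilt_eq_of_notMem_gapSet hh hu ht fun hc => ?_
  obtain ⟨p, hp, htp⟩ := exists_gap hh hu hc
  exact hg p hp htp

lemma tilt_eq_at_endpoints (hh : IsDistortion h) (hu : EqOn h (uscMod h) (Icc 0 1)) {p : ℝ × ℝ}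
    (hp : p ∈ gaps h) :
    tilt h p.1 = tilt (concaveEnv h) p.1 ∧ tilt h p.2 = tilt (concaveEnv h) p.2 :=
  ⟨tilt_eq_of_notMem_gapSet hh hu ((isFamily_gaps h).mem_Icc hp).1 hp.2.2.1,
    tilt_eq_of_notMem_gapSet hh hu ((isFamily_gaps h).mem_Icc hp).2 hp.2.2.2⟩

/-- The envelope is affine on every compact interval on which it is away from the function. -/
lemma le_chord_of_Icc_subset_gapSet (hh : IsDistortion h) (hu : EqOn h (uscMod h) (Icc 0 1))
    {q : ℝ × ℝ} (hq : q.1 < q.2) (hsub : Icc q.1 q.2 ⊆ gapSet h) {t : ℝ} (ht : t ∈ Ioo q.1 q.2) :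
    tilt (concaveEnv h) t ≤ chord (tilt (concaveEnv h)) q t := by
  set g := tilt (concaveEnv h) with hg
  have gc : ConcaveOn ℝ (Icc 0 1) g := concaveOn_tilt hh
  have gpos : ∀ t, 0 ≤ g t := tilt_concaveEnv_nonneg hh
  have g0 : g 0 = 0 := tilt_zero (isDistortion_concaveEnv hh)
  have sub01 : Icc q.1 q.2 ⊆ Ioo 0 1 := fun s hs => ((mem_gapSet_iff hh hu).1 (hsub hs)).1
  have q1 := sub01 (left_mem_Icc.2 hq.le)
  have q2 := sub01 (right_mem_Icc.2 hq.le)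
  have F : IsFamily (({q} : Finset (ℝ × ℝ)) : Set (ℝ × ℝ)) := by
    rw [Finset.coe_singleton]; exact isFamily_singleton q1.1.le hq q2.2.le
  have lsc : LowerSemicontinuousOn (fun s => concaveEnv h s - h s) (Icc q.1 q.2) :=
    fun s hs y hy => nhdsWithin_le_nhds (eventually_lt_concaveEnv_sub hh hu (sub01 hs) hy)
  -- A lower semicontinuous function attains its minimum on a compact interval, so the distance to
  -- the envelope is bounded below by some $\delta>0$.
  obtain ⟨s₀, hs₀, hmin⟩ := lsc.exists_isMinOn (nonempty_Icc.2 hq.le) isCompact_Icc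
  set δ := concaveEnv h s₀ - h s₀
  have δpos : 0 < δ := sub_pos.2 ((mem_gapSet_iff hh hu).1 (hsub hs₀)).2
  have hle : ∀ s ∈ Icc q.1 q.2, tilt h s ≤ g s - δ := by
    intro s hs
    have h1 : δ ≤ concaveEnv h s - h s := hmin hs
    have hs' := Ioo_subset_Icc_self (sub01 hs)
    rw [hg, tilt_of_mem _ hs', tilt_of_mem _ hs', concaveEnv_one hh]
    linarith
  obtain ⟨K, hK⟩ : ∃ K, ∀ s ∈ Icc q.1 q.2, g s ≤ K := by
    have : ContinuousOn g (Icc q.1 q.2) := fun s hs =>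
      (continuousAt_of_concaveOn gc (sub01 hs)).continuousWithinAt
    obtain ⟨K, hK⟩ := (isCompact_Icc.image_of_continuousOn this).bddAbove
    exact ⟨K, fun s hs => hK (mem_image_of_mem _ hs)⟩
  have Kpos : 0 ≤ K := (gpos q.1).trans (hK _ (left_mem_Icc.2 hq.le))
  -- With this choice $\varepsilon g\le\varepsilon K<\delta$ on the interval, so $(1-\varepsilon)g$
  -- still exceeds $\tilde h\le g-\delta$. Mixing $g$ with its chord version therefore gives a
  -- concave majorant. The summand $\delta$ in the denominator covers $K=0$.
  set ε := δ / (K + δ)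
  have εpos : 0 < ε := div_pos δpos (by linarith)
  have ε1 : ε ≤ 1 := (div_le_one (by linarith)).2 (by linarith)
  have εK : ε * (K + δ) = δ := div_mul_cancel₀ _ (by linarith)
  set c := chordal {q} g
  have cc : ConcaveOn ℝ (Icc 0 1) c := concaveOn_chordal _ F g gc
  have cpos : ∀ s, 0 ≤ c s := chordal_nonneg F gpos
  have cout : ∀ s, s ∉ Ioo q.1 q.2 → c s = g s := fun s hs =>
    chordal_of_notMem g (by simpa using hs)
  have wc : ConcaveOn ℝ (Icc 0 1) (fun s => (1 - ε) * g s + ε * c s) :=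
    (gc.smul (by linarith : (0:ℝ) ≤ 1 - ε)).add (cc.smul εpos.le)
  have c0 : c 0 = 0 := by
    rw [cout 0 (fun h => by linarith [h.1, q1.1]), g0]
  have key := tilt_concaveEnv_le (t := t) wc (by simp [g0, c0]) hh (fun s hs => ?_)
    (Ioo_subset_Icc_self (sub01 (Ioo_subset_Icc_self ht)))
  · rw [← chordal_of_mem F g (Finset.mem_singleton_self q) ht]
    have h3 : ε * g t ≤ ε * c t := by linarith
    exact le_of_mul_le_mul_left h3 εpos
  · by_cases hsq : s ∈ Ioo q.1 q.2
    · have hsq' := Ioo_subset_Icc_self hsq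
      have h1 := hle s hsq'
      have h2 := mul_nonneg εpos.le (cpos s)
      have h3 := mul_le_mul_of_nonneg_left (hK s hsq') εpos.le
      have h4 := mul_pos εpos δpos
      have h5 : ε * K + ε * δ = δ := by rw [← mul_add, εK]
      linarith
    · rw [cout s hsq]
      have := tilt_le_tilt_concaveEnv hh s
      linarith

/-- The envelope is affine on every compact subinterval of the gap. Continuity up to the ends
carries this to the chord over the whole gap; if the envelope jumped at $0$ or $1$, the chord would
be too low. -/
lemma chord_eq_on_gap (hh : IsDistortion h) (hu : EqOn h (uscMod h) (Icc 0 1)) {p : ℝ × ℝ}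
    (hp : p ∈ gaps h) (hcont : ContinuousOn (concaveEnv h) (Icc p.1 p.2)) {t : ℝ}
    (ht : t ∈ Ioo p.1 p.2) :
    chord (tilt (concaveEnv h)) p t = tilt (concaveEnv h) t := by
  set g := tilt (concaveEnv h) with hg
  have F := isFamily_gaps h
  obtain ⟨m1, m2⟩ := F.mem_Icc hp
  have hlt := F.lt p hp
  have gcont : ContinuousOn g (Icc p.1 p.2) := by
    have : ContinuousOn (fun t => concaveEnv h t - concaveEnv h 1 * t) (Icc p.1 p.2) := by fun_prop
    exact this.congr fun s hs => tilt_of_mem _ ⟨m1.1.trans hs.1, hs.2.trans m2.2⟩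
  refine le_antisymm (chord_le (concaveOn_tilt hh) hlt m1 m2 (Ioo_subset_Icc_self ht)) ?_
  rw [chord_eq g hlt, le_div_iff₀ (by linarith)]
  have hs : ∀ s ∈ Ioo (0:ℝ) 1, g t * (p.2 - p.1) ≤
      (p.2 - t) * g (p.1 + s * (t - p.1)) + (t - p.1) * g (p.2 - s * (p.2 - t)) := by
    intro s hs
    have e1 : 0 < t - p.1 := sub_pos.2 ht.1
    have e2 : 0 < p.2 - t := sub_pos.2 ht.2
    have f1 := mul_pos hs.1 e1
    have f2 := mul_pos hs.1 e2
    have f3 := mul_pos (sub_pos.2 hs.2) e1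
    have f4 := mul_pos (sub_pos.2 hs.2) e2
    -- The gap contracted towards `t` by the factor $1-s$. All three lengths in the chord formula
    -- scale by this factor, which cancels; then $s\to0$.
    set q : ℝ × ℝ := (p.1 + s * (t - p.1), p.2 - s * (p.2 - t)) with hq
    have l1 : q.1 < t := by simp only [hq]; linarith
    have l2 : t < q.2 := by simp only [hq]; linarith
    have := le_chord_of_Icc_subset_gapSet hh hu (l1.trans l2) (fun r hr => hp.2.1
      ⟨by have := hr.1; simp only [hq] at this; linarith,
        by have := hr.2; simp only [hq] at this; linarith⟩) ⟨l1, l2⟩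
    rw [← hg, chord_eq g (l1.trans l2), le_div_iff₀ (sub_pos.2 (l1.trans l2))] at this
    have r1 : q.2 - q.1 = (1 - s) * (p.2 - p.1) := by simp only [hq]; ring
    have r2 : q.2 - t = (1 - s) * (p.2 - t) := by simp only [hq]; ring
    have r3 : t - q.1 = (1 - s) * (t - p.1) := by simp only [hq]; ring
    rw [r1, r2, r3] at this
    have pos : 0 < 1 - s := sub_pos.2 hs.2
    refine le_of_mul_le_mul_left ?_ pos
    simp only [hq] at this
    linarith
  have T : Filter.Tendsto (fun s : ℝ => (p.2 - t) * g (p.1 + s * (t - p.1)) +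
      (t - p.1) * g (p.2 - s * (p.2 - t))) (nhdsWithin 0 (Ioo 0 1))
      (nhds ((p.2 - t) * g p.1 + (t - p.1) * g p.2)) := by
    have c1 : ContinuousOn (fun s : ℝ => (p.2 - t) * g (p.1 + s * (t - p.1)) +
        (t - p.1) * g (p.2 - s * (p.2 - t))) (Icc 0 1) := by
      have e1 : 0 < t - p.1 := sub_pos.2 ht.1
      have e2 : 0 < p.2 - t := sub_pos.2 ht.2
      refine ((gcont.comp (by fun_prop) ?_).const_mul _).add
        ((gcont.comp (by fun_prop) ?_).const_mul _)
      · intro s hs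
        have f1 := mul_nonneg hs.1 e1.le
        have f3 := mul_nonneg (sub_nonneg.2 hs.2) e1.le
        constructor <;> linarith
      · intro s hs
        have f1 := mul_nonneg hs.1 e2.le
        have f3 := mul_nonneg (sub_nonneg.2 hs.2) e2.le
        constructor <;> linarith
    have := (c1 0 (left_mem_Icc.2 zero_le_one)).tendsto.mono_left
      (nhdsWithin_mono 0 Ioo_subset_Icc_self)
    simpa using this
  have : (nhdsWithin (0:ℝ) (Ioo 0 1)).NeBot := by
    rw [nhdsWithin_Ioo_eq_nhdsGT zero_lt_one]; infer_instance
  refine ge_of_tendsto T ?_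
  filter_upwards [self_mem_nhdsWithin] with s hs' using hs s hs'

end Gaps

/-! ### Atomless probability spaces -/

section Atomless

variable {Ω : Type*} [MeasurableSpace Ω] {P : Measure Ω} [IsProbabilityMeasure P]

lemma Atomless.exists_small (hP : Atomless P) {A : Set Ω} (hA : MeasurableSet A)
    (hA0 : 0 < P.real A) {ε : ℝ} (hε : 0 < ε) :
    ∃ B, MeasurableSet B ∧ B ⊆ A ∧ 0 < P.real B ∧ P.real B ≤ ε := by
  have half : ∀ A, MeasurableSet A → 0 < P.real A →
      ∃ B, MeasurableSet B ∧ B ⊆ A ∧ 0 < P.real B ∧ P.real B ≤ P.real A / 2 := by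
    intro A hA hA0
    have hA0' : 0 < P A := (ENNReal.toReal_pos_iff.1 hA0).1
    obtain ⟨B, hB, hBA, h0, h1⟩ := hP A hA hA0'
    have h0' : 0 < P.real B := ENNReal.toReal_pos h0.ne' (measure_ne_top P B)
    have h1' : P.real B < P.real A := (ENNReal.toReal_lt_toReal (measure_ne_top P B)
      (measure_ne_top P A)).2 h1
    have hd := measureReal_sdiff (μ := P) hBA hB
    -- One of `B` and `A \ B` has at most half the mass, and both have positive mass.
    rcases le_or_gt (P.real B) (P.real A / 2) with h | h
    · exact ⟨B, hB, hBA, h0', h⟩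
    · exact ⟨A \ B, hA.diff hB, sdiff_subset, by rw [hd]; linarith, by rw [hd]; linarith⟩
  have iter : ∀ n : ℕ, ∃ B, MeasurableSet B ∧ B ⊆ A ∧ 0 < P.real B ∧
      P.real B ≤ P.real A * (1 / 2) ^ n := by
    intro n
    induction n with
    | zero => exact ⟨A, hA, subset_rfl, hA0, by simp⟩
    | succ n ih =>
      obtain ⟨B, h1, h2, h3, h4⟩ := ih
      obtain ⟨C, k1, k2, k3, k4⟩ := half B h1 h3
      refine ⟨C, k1, k2.trans h2, k3, ?_⟩
      rw [pow_succ]; linarith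
  obtain ⟨n, hn⟩ := exists_pow_lt_of_lt_one (div_pos hε hA0) (by norm_num : (1 / 2 : ℝ) < 1)
  obtain ⟨B, h1, h2, h3, h4⟩ := iter n
  refine ⟨B, h1, h2, h3, h4.trans ?_⟩
  have := (lt_div_iff₀ hA0).1 hn
  linarith

/-- An atomless probability measure takes all values between `0` and `P A` on the subsets of `A`. -/
lemma Atomless.exists_eq (hP : Atomless P) {A : Set Ω} (hA : MeasurableSet A) {r : ℝ}
    (hr0 : 0 ≤ r) (hr : r ≤ P.real A) : ∃ B, MeasurableSet B ∧ B ⊆ A ∧ P.real B = r := by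
  let S := {C : Set Ω // MeasurableSet C ∧ C ⊆ A ∧ P.real C ≤ r}
  -- A greedy step: enlarge `C` until no admissible superset of `C` has mass larger by $2^{-n}$ or
  -- more.
  have next : ∀ (n : ℕ) (C : S), ∃ C' : S, C.1 ⊆ C'.1 ∧
      ∀ C'' : S, C.1 ⊆ C''.1 → P.real C''.1 < P.real C'.1 + (1 / 2) ^ n := by
    intro n C
    let V : Set ℝ := {v | ∃ C' : S, C.1 ⊆ C'.1 ∧ v = P.real C'.1}
    have hV : V.Nonempty := ⟨_, C, subset_rfl, rfl⟩
    have hb : BddAbove V := ⟨r, by rintro _ ⟨C', -, rfl⟩; exact C'.2.2.2⟩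
    have pos : (0:ℝ) < (1 / 2) ^ n := by positivity
    obtain ⟨_, ⟨C', hC', rfl⟩, hlt⟩ := exists_lt_of_lt_csSup hV
      (show sSup V - (1 / 2) ^ n < sSup V by linarith)
    refine ⟨C', hC', fun C'' h => ?_⟩
    have := le_csSup hb ⟨C'', h, rfl⟩
    linarith
  choose nx hnx1 hnx2 using next
  let C : ℕ → S := fun n => Nat.rec ⟨∅, MeasurableSet.empty, empty_subset _, by simpa using hr0⟩
    (fun n C => nx n C) n
  have Csucc : ∀ n, C (n + 1) = nx n (C n) := fun n => rfl
  have Cmono : Monotone fun n => (C n).1 := by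
    refine monotone_nat_of_le_succ fun n => ?_
    rw [Csucc]; exact hnx1 n (C n)
  have hm : MeasurableSet (⋃ n, (C n).1) := MeasurableSet.iUnion fun n => (C n).2.1
  have hsub : (⋃ n, (C n).1) ⊆ A := iUnion_subset fun n => (C n).2.2.1
  have hle : P.real (⋃ n, (C n).1) ≤ r := by
    have := tendsto_measure_iUnion_atTop (μ := P) Cmono
    have := (ENNReal.tendsto_toReal (measure_ne_top P _)).comp this
    exact le_of_tendsto' this fun n => (C n).2.2.2
  refine ⟨_, hm, hsub, le_antisymm hle ?_⟩
  by_contra hlt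
  push Not at hlt
  have hd := measureReal_sdiff (μ := P) hsub hm
  -- If the union fell short of `r`, a small piece `E` of positive mass could be added. For $2^{-n}$
  -- below that mass, this contradicts the greedy choice at step `n`.
  obtain ⟨E, e1, e2, e3, e4⟩ := hP.exists_small (hA.diff hm) (by rw [hd]; linarith)
    (sub_pos.2 hlt)
  have hu : P.real ((⋃ n, (C n).1) ∪ E) = P.real (⋃ n, (C n).1) + P.real E :=
    measureReal_union (disjoint_left.2 fun ω h1 h2 => (e2 h2).2 h1) e1
  let D : S := ⟨(⋃ n, (C n).1) ∪ E, hm.union e1, union_subset hsub (e2.trans sdiff_subset), by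
    rw [hu]; linarith⟩
  obtain ⟨n, hn⟩ := exists_pow_lt_of_lt_one e3 (by norm_num : (1 / 2 : ℝ) < 1)
  have h1 := hnx2 n (C n) D ((subset_iUnion (fun n => (C n).1) n).trans subset_union_left)
  rw [← Csucc] at h1
  have h2 : P.real (C (n + 1)).1 ≤ P.real (⋃ n, (C n).1) :=
    measureReal_mono (subset_iUnion (fun n => (C n).1) (n + 1))
  have h3 : P.real D.1 = P.real (⋃ n, (C n).1) + P.real E := hu
  linarith

/-- The next binary digit. -/
lemma Atomless.exists_refine (hP : Atomless P) {K : Ω → ℕ} (hK : Measurable K) :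
    ∃ K' : Ω → ℕ, Measurable K' ∧ (∀ ω, K' ω = 2 * K ω ∨ K' ω = 2 * K ω + 1) ∧
      ∀ m, P.real {ω | K' ω = 2 * m} = P.real {ω | K ω = m} / 2 := by
  have hm : ∀ m, MeasurableSet {ω | K ω = m} := fun m => hK (measurableSet_singleton m)
  have := fun m => hP.exists_eq (hm m) (r := P.real {ω | K ω = m} / 2)
    (div_nonneg measureReal_nonneg zero_le_two)
    (half_le_self measureReal_nonneg)
  choose H h1 h2 h3 using this
  have hU : MeasurableSet (⋃ m, H m) := MeasurableSet.iUnion h1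
  classical
  refine ⟨fun ω => if ω ∈ ⋃ m, H m then 2 * K ω else 2 * K ω + 1,
    Measurable.ite hU (by fun_prop) (by fun_prop), fun ω => ?_, fun m => ?_⟩
  · by_cases hω : ω ∈ ⋃ m, H m
    · exact Or.inl (if_pos hω)
    · exact Or.inr (if_neg hω)
  · rw [← h3 m]
    congr 1
    ext ω
    simp only [mem_ofPred_eq]
    constructor
    · intro h
      split_ifs at h with hω
      · obtain ⟨k, hk⟩ := mem_iUnion.1 hω
        have : K ω = k := h2 k hk
        have : k = m := by omega
        exact this ▸ hk
      · omega
    · intro h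
      rw [if_pos (mem_iUnion.2 ⟨m, h⟩)]
      have : K ω = m := h2 m h
      rw [this]

/-- On an atomless probability space there is a uniformly distributed random variable. -/
theorem Atomless.exists_uniform (hP : Atomless P) :
    ∃ U : Ω → ℝ, Measurable U ∧ P.map U = unif := by
  choose nx hnx using fun K : {K : Ω → ℕ // Measurable K} => hP.exists_refine K.2
  let Ks : ℕ → {K : Ω → ℕ // Measurable K} := fun n => Nat.rec ⟨fun _ => 0, measurable_const⟩
    (fun _ K => ⟨nx K, (hnx K).1⟩) n
  let K : ℕ → Ω → ℕ := fun n => (Ks n).1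
  have K0 : ∀ ω, K 0 ω = 0 := fun ω => rfl
  have Km : ∀ n, Measurable (K n) := fun n => (Ks n).2
  have Ks1 : ∀ n ω, K (n + 1) ω = 2 * K n ω ∨ K (n + 1) ω = 2 * K n ω + 1 :=
    fun n ω => (hnx (Ks n)).2.1 ω
  have Ks2 : ∀ n m, P.real {ω | K (n + 1) ω = 2 * m} = P.real {ω | K n ω = m} / 2 :=
    fun n m => (hnx (Ks n)).2.2 m
  have split : ∀ n m, P.real {ω | K n ω < m + 1} =
      P.real {ω | K n ω < m} + P.real {ω | K n ω = m} := by
    intro n m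
    rw [← measureReal_union]
    · congr 1; ext ω; simp only [mem_ofPred_eq, mem_union]; omega
    · exact disjoint_left.2 fun ω h1 h2 => by
        simp only [mem_ofPred_eq] at h1 h2; omega
    · exact Km n (measurableSet_singleton m)
  -- The first `n` binary digits, read as an integer, are uniform on $\{0,\dots,2^n-1\}$. Even
  -- thresholds reduce to the previous stage; odd ones add half of one cell.
  have law : ∀ n m : ℕ, m ≤ 2 ^ n → P.real {ω | K n ω < m} = m / 2 ^ n := by
    intro n
    induction n with
    | zero =>
      intro m hm
      rw [pow_zero] at hm
      interval_cases m
      · simp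
      · simp [K0]
    | succ n ih =>
      have even : ∀ m : ℕ, m ≤ 2 ^ n → P.real {ω | K (n + 1) ω < 2 * m} = m / 2 ^ n := by
        intro m hm
        rw [← ih m hm]
        congr 1; ext ω; simp only [mem_ofPred_eq]
        rcases Ks1 n ω with h | h <;> omega
      intro m hm
      rw [pow_succ] at hm
      obtain ⟨k, rfl | rfl⟩ := Nat.even_or_odd' m
      · rw [even k (by omega), pow_succ]; push_cast; field_simp
      · rw [split (n + 1) (2 * k), even k (by omega), Ks2]
        have h1 := split n k
        rw [ih k (by omega), ih (k + 1) (by omega)] at h1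
        have h2 : P.real {ω | K n ω = k} = 1 / 2 ^ n := by
          push_cast at h1
          have : ((k:ℝ) + 1) / 2 ^ n = k / 2 ^ n + 1 / 2 ^ n := by ring
          linarith
        rw [h2, pow_succ]; push_cast; field_simp
  let V : ℕ → Ω → ℝ := fun n ω => (K n ω : ℝ) / 2 ^ n
  have Vm : ∀ n, Measurable (V n) := fun n => by
    have := Km n
    fun_prop
  have Vmono : ∀ ω, Monotone fun n => V n ω := by
    intro ω
    refine monotone_nat_of_le_succ fun n => ?_
    simp only [V]
    rw [div_le_div_iff₀ (by positivity) (by positivity), pow_succ]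
    have : (2 * K n ω : ℝ) ≤ K (n + 1) ω := by
      have : 2 * K n ω ≤ K (n + 1) ω := by rcases Ks1 n ω with h | h <;> omega
      exact_mod_cast this
    nlinarith [pow_pos (two_pos : (0:ℝ) < 2) n]
  -- The upper ends of the dyadic cells decrease while the lower ends `V` increase, so the limit `U`
  -- lies in all the closed cells.
  have Wanti : ∀ ω, Antitone fun n => ((K n ω : ℝ) + 1) / 2 ^ n := by
    intro ω
    refine antitone_nat_of_succ_le fun n => ?_
    rw [div_le_div_iff₀ (by positivity) (by positivity), pow_succ]
    have : (K (n + 1) ω : ℝ) ≤ 2 * K n ω + 1 := by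
      have : K (n + 1) ω ≤ 2 * K n ω + 1 := by rcases Ks1 n ω with h | h <;> omega
      exact_mod_cast this
    nlinarith [pow_pos (two_pos : (0:ℝ) < 2) n]
  have VW : ∀ ω m n, V m ω ≤ ((K n ω : ℝ) + 1) / 2 ^ n := by
    intro ω m n
    calc V m ω ≤ V (max m n) ω := Vmono ω (le_max_left m n)
      _ ≤ ((K (max m n) ω : ℝ) + 1) / 2 ^ (max m n) := by
          simp only [V]; gcongr; linarith
      _ ≤ _ := Wanti ω (le_max_right m n)
  let U : Ω → ℝ := fun ω => ⨆ n, V n ω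
  have hb : ∀ ω, BddAbove (range fun n => V n ω) := fun ω =>
    ⟨_, by rintro _ ⟨m, rfl⟩; exact VW ω m 0⟩
  have UW : ∀ ω n, U ω ≤ ((K n ω : ℝ) + 1) / 2 ^ n := fun ω n => ciSup_le fun m => VW ω m n
  have VU : ∀ ω n, V n ω ≤ U ω := fun ω n => le_ciSup (hb ω) n
  have Um : Measurable U := Measurable.iSup Vm
  have U0 : ∀ ω, 0 ≤ U ω := fun ω => le_trans (by simp only [V]; positivity) (VU ω 0)
  have U1 : ∀ ω, U ω ≤ 1 := fun ω => (UW ω 0).trans (by simp [K0])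
  have cdf : ∀ x ∈ Ico (0:ℝ) 1, P.real {ω | U ω ≤ x} = x := by
    intro x hx
    have key : ∀ n : ℕ, |P.real {ω | U ω ≤ x} - x| ≤ (1 / 2) ^ n := by
      intro n
      have p2 : (0:ℝ) < 2 ^ n := by positivity
      set m := ⌊2 ^ n * x⌋₊ with hm
      have m1 : (m:ℝ) ≤ 2 ^ n * x := Nat.floor_le (mul_nonneg p2.le hx.1)
      have m2 : 2 ^ n * x < m + 1 := Nat.lt_floor_add_one _
      have m3 : m < 2 ^ n := by
        have : (m:ℝ) < 2 ^ n := by nlinarith [hx.2]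
        exact_mod_cast this
      have lo : (m:ℝ) / 2 ^ n ≤ P.real {ω | U ω ≤ x} := by
        rw [← law n m m3.le]
        refine measureReal_mono fun ω hω => ?_
        simp only [mem_ofPred_eq] at hω ⊢
        refine (UW ω n).trans ?_
        rw [div_le_iff₀ p2]
        have : ((K n ω : ℝ) + 1) ≤ m := by exact_mod_cast hω
        linarith
      have hi : P.real {ω | U ω ≤ x} ≤ ((m + 1 : ℕ) : ℝ) / 2 ^ n := by
        rw [← law n (m + 1) m3]
        refine measureReal_mono fun ω hω => ?_
        simp only [mem_ofPred_eq] at hω ⊢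
        have h1 := (VU ω n).trans hω
        simp only [V] at h1
        rw [div_le_iff₀ p2] at h1
        have : (K n ω : ℝ) < m + 1 := by linarith
        exact_mod_cast this
      rw [div_le_iff₀ p2] at lo
      rw [le_div_iff₀ p2] at hi
      push_cast at hi
      have e : (1 / 2 : ℝ) ^ n * 2 ^ n = 1 := by rw [← mul_pow]; norm_num
      rw [abs_le]
      constructor <;> refine le_of_mul_le_mul_right ?_ p2 <;> linarith
    have : |P.real {ω | U ω ≤ x} - x| ≤ 0 := ge_of_tendsto'
      (tendsto_pow_atTop_nhds_zero_of_lt_one (by norm_num) (by norm_num : (1 / 2 : ℝ) < 1)) key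
    have := abs_nonpos_iff.1 this
    linarith
  refine ⟨U, Um, ?_⟩
  have := Measure.isProbabilityMeasure_map (μ := P) Um.aemeasurable
  refine Measure.ext_of_Iic _ _ fun x => ?_
  rw [← measureReal_eq_measureReal_iff, map_measureReal_apply Um measurableSet_Iic]
  have hpre : U ⁻¹' Iic x = {ω | U ω ≤ x} := rfl
  rw [hpre, measureReal_def unif, unif, Measure.restrict_apply measurableSet_Iic]
  rcases lt_or_ge x 0 with h | h
  · have e1 : {ω | U ω ≤ x} = ∅ := by
      ext ω; simp only [mem_ofPred_eq, mem_empty_iff_false, iff_false, not_le]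
      exact h.trans_le (U0 ω)
    have e2 : Iic x ∩ Icc 0 1 = ∅ := by
      ext u; simp only [mem_inter_iff, mem_Iic, mem_Icc, mem_empty_iff_false, iff_false]
      rintro ⟨h1, h2, -⟩; linarith
    rw [e1, e2]; simp
  rcases lt_or_ge x 1 with h' | h'
  · rw [cdf x ⟨h, h'⟩]
    have e2 : Iic x ∩ Icc 0 1 = Icc 0 x := by
      ext u; simp only [mem_inter_iff, mem_Iic, mem_Icc]
      constructor
      · rintro ⟨h1, h2, -⟩; exact ⟨h2, h1⟩
      · rintro ⟨h1, h2⟩; exact ⟨h2, h1, by linarith⟩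
    rw [e2, Real.volume_Icc, ENNReal.toReal_ofReal] <;> linarith
  · have e1 : {ω | U ω ≤ x} = univ := by
      ext ω; simp only [mem_ofPred_eq, mem_univ, iff_true]
      exact (U1 ω).trans h'
    have e2 : Iic x ∩ Icc 0 1 = Icc (0:ℝ) 1 :=
      inter_eq_right.2 fun u hu => hu.2.trans h'
    rw [e1, e2]; simp

lemma indicator_ae_eq_unif (f : ℝ → ℝ) : (Ioo (0:ℝ) 1).indicator f =ᵐ[unif] f := by
  rw [unif_eq]; exact indicator_ae_eq_restrict measurableSet_Ioo

/-- Every concentration of a distribution is the law of a conditional expectation. -/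
lemma concAll_mem_of_closedCondExp (hP : Atomless P) {M : Set (Measure ℝ)}
    (hM : ClosedCondExp P M) {μ : Measure ℝ} (hμ : μ ∈ finiteMean) (hμM : μ ∈ M)
    {J : Set (ℝ × ℝ)} (hJ : IsFamily J) : concAll (levels '' J) μ ∈ M := by
  have := hμ.1
  obtain ⟨U, hU, hUP⟩ := hP.exists_uniform
  -- Cutting off outside $(0,1)$, a null set for `unif`, makes both functions measurable everywhere.
  set q := (Ioo (0:ℝ) 1).indicator (quantile μ)
  set f := (Ioo (0:ℝ) 1).indicator (concFun (levels '' J) μ) with hf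
  have qm : Measurable q :=
    measurable_indicator_of_monotoneOn measurableSet_Ioo (monotoneOn_quantile μ)
  have fm : Measurable f :=
    measurable_indicator_of_monotoneOn measurableSet_Ioo (monotoneOn_concFun hμ hJ)
  have qe : q =ᵐ[unif] quantile μ := indicator_ae_eq_unif _
  have fe : f =ᵐ[unif] concFun (levels '' J) μ := indicator_ae_eq_unif _
  obtain ⟨fi, feq⟩ := concFun_setIntegral hμ hJ
  have qi : Integrable q unif := (integrable_quantile hμ).1.congr qe.symm
  have fi' : Integrable f unif := fi.congr fe.symm
  have lawq : law P (q ∘ U) = μ := by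
    rw [law, ← Measure.map_map qm hU, hUP, Measure.map_congr qe, map_quantile]
  have lawf : law P (f ∘ U) = concAll (levels '' J) μ := by
    rw [law, ← Measure.map_map fm hU, hUP, Measure.map_congr fe, concAll_eq]
  have fUm : Measurable (f ∘ U) := fm.comp hU
  have qUi : Integrable (q ∘ U) P := by
    rw [← hUP] at qi; exact qi.comp_measurable hU
  have fUi : Integrable (f ∘ U) P := by
    rw [← hUP] at fi'; exact fi'.comp_measurable hU
  -- Conditioning is on the concentrated variable itself. It is constant on each level interval, so
  -- its events cut no interval, as `concFun_setIntegral` requires.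
  have hc := hM (q ∘ U) (qm.comp hU) (lawq.symm ▸ hμM) (MeasurableSpace.comap (f ∘ U) inferInstance)
    fUm.comap_le
  have ae : f ∘ U =ᵐ[P] condExp (MeasurableSpace.comap (f ∘ U) inferInstance) P (q ∘ U) := by
    refine ae_eq_condExp_of_forall_setIntegral_eq fUm.comap_le qUi
      (fun _ _ _ => fUi.integrableOn) ?_
      (comap_measurable (f ∘ U)).stronglyMeasurable.aestronglyMeasurable
    rintro _ ⟨S, hS, rfl⟩ -
    have e : ∀ g : ℝ → ℝ, Measurable g →
        ∫ ω in (f ∘ U) ⁻¹' S, (g ∘ U) ω ∂P = ∫ u in f ⁻¹' S, g u ∂unif := by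
      intro g hg
      rw [← hUP, setIntegral_map (fm hS) hg.aestronglyMeasurable hU.aemeasurable]
      rfl
    rw [e f fm, e q qm, integral_congr_ae (ae_restrict_of_ae fe),
      integral_congr_ae (ae_restrict_of_ae qe)]
    refine feq _ (fm hS) fun p hp => ?_
    have val : ∀ u ∈ levels p, f u = avg μ p := fun u hu => by
      rw [hf, indicator_of_mem (hJ.levels_subset hp hu), concFun_of_mem hJ μ hp hu]
    by_cases h : avg μ p ∈ S
    · exact Or.inl fun u hu => by rw [mem_preimage, val u hu]; exact h
    · exact Or.inr (disjoint_left.2 fun u hu hu' => by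
        rw [mem_preimage, val u hu] at hu'; exact h hu')
  rw [law, ← Measure.map_congr ae] at hc
  rwa [← lawf]

end Atomless

/-! ### Comparison of the suprema -/

lemma extInt_mono {α : Type*} [MeasurableSpace α] {μ : Measure α} {f f' : α → ℝ}
    (h : ∀ x, f x ≤ f' x) : extInt f μ ≤ extInt f' μ := by
  refine EReal.sub_le_sub ?_ ?_
  · exact EReal.coe_ennreal_le_coe_ennreal_iff.2
      (lintegral_mono fun x => ENNReal.ofReal_le_ofReal (h x))
  · exact EReal.coe_ennreal_le_coe_ennreal_iff.2
      (lintegral_mono fun x => ENNReal.ofReal_le_ofReal (neg_le_neg (h x)))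

section Comparison

variable {h : ℝ → ℝ} {M : Set (Measure ℝ)}

lemma rhoNeg_concaveEnv_ne_top (hh : IsDistortion h) {μ : Measure ℝ} (hμ : μ ∈ finiteMean) :
    rhoNeg (concaveEnv h) μ ≠ ⊤ := by
  rw [rhoNeg_ne_top_iff (measurable_tilt (isDistortion_concaveEnv hh)) hμ]
  have : ∀ x : ℝ, ENNReal.ofReal (-tilt (concaveEnv h) (μ.real (Ioi x))) = 0 := fun x =>
    ENNReal.ofReal_of_nonpos (neg_nonpos.2 (tilt_concaveEnv_nonneg hh _))
  simp [this]

lemma rho_concaveEnv_eq (hh : IsDistortion h) {μ : Measure ℝ} (hμ : μ ∈ finiteMean) :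
    rho (concaveEnv h) μ =
      ((∫⁻ x, ENNReal.ofReal (tilt (concaveEnv h) (μ.real (Ioi x))) : ENNReal) : EReal) +
        ((h 1 * ∫ x, x ∂μ : ℝ) : EReal) := by
  rw [rho_eq (measurable_tilt (isDistortion_concaveEnv hh)) hμ, concaveEnv_one hh,
    extInt_of_nonneg fun x => tilt_concaveEnv_nonneg hh _]

lemma rho_le_supRho {μ : Measure ℝ} (hμ : μ ∈ M) (hd : RhoDefined h μ) : rho h μ ≤ supRho h M :=
  le_sSup ⟨μ, hμ, hd, rfl⟩

lemma supRho_le_supRho_concaveEnv (hM : M ⊆ finiteMean) (hh : IsDistortion h) :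
    supRho h M ≤ supRho (concaveEnv h) M := by
  refine sSup_le ?_
  rintro _ ⟨μ, hμ, -, rfl⟩
  refine le_trans ?_ (rho_le_supRho hμ (Or.inr (rhoNeg_concaveEnv_ne_top hh (hM hμ))))
  rw [rho_eq (measurable_tilt hh) (hM hμ),
    rho_eq (measurable_tilt (isDistortion_concaveEnv hh)) (hM hμ), concaveEnv_one hh]
  exact add_le_add_left (extInt_mono fun x => tilt_le_tilt_concaveEnv hh _) _

/-- Successive concentrations make it possible to evaluate `ρ` with `h` replaced by its chords. -/
lemma extInt_chordal_le_supRho (hM : M ⊆ finiteMean) (hh : IsDistortion h) {J : Finset (ℝ × ℝ)}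
    (hJ : IsFamily (J : Set (ℝ × ℝ))) (hc : ∀ p ∈ J, ∀ μ ∈ M, conc (levels p) μ ∈ M)
    {μ : Measure ℝ} (hμ : μ ∈ M)
    (hneg : ∫⁻ x, ENNReal.ofReal (-chordal J (tilt h) (μ.real (Ioi x))) ≠ ⊤) :
    extInt (fun x => chordal J (tilt h) (μ.real (Ioi x))) volume ≤
      supRho h M - ((h 1 * ∫ x, x ∂μ : ℝ) : EReal) := by
  obtain ⟨ν, hν, hmean, hφ⟩ := exists_conc hM J hJ hc μ hμ
  have := (hM hμ).1
  have := (hM hν).1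
  obtain ⟨hi, he⟩ := hφ (tilt h)
  have m1 : Measurable fun x => chordal J (tilt h) (μ.real (Ioi x)) :=
    (measurable_chordal J (measurable_tilt hh)).comp (measurable_tail μ)
  have m2 := measurable_tilt_tail (measurable_tilt hh) ν
  have e1 := extInt_eq_add m1 m2 hi
  rw [he, EReal.coe_zero, add_zero] at e1
  have d : RhoDefined h ν := by
    refine Or.inr ((rhoNeg_ne_top_iff (measurable_tilt hh) (hM hν)).2 ?_)
    refine lintegral_ofReal_ne_top_of_sub m1.neg ?_ hneg
    refine hi.neg.congr (ae_of_all _ fun x => ?_)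
    simp only [Pi.neg_apply]; ring
  have e2 := rho_le_supRho hν d
  rw [rho_eq (measurable_tilt hh) (hM hν), e1, hmean] at e2
  rw [EReal.le_sub_iff_add_le (Or.inl (EReal.coe_ne_bot _)) (Or.inl (EReal.coe_ne_top _))]
  exact e2

/-- The mean term is real and can be moved across in `EReal`; what remains on the left is a
nonnegative integral, suited to monotone limits. -/
lemma supRho_concaveEnv_le (hM : M ⊆ finiteMean) (hh : IsDistortion h)
    (H : ∀ μ ∈ M,
      ((∫⁻ x, ENNReal.ofReal (tilt (concaveEnv h) (μ.real (Ioi x))) : ENNReal) : EReal) ≤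
      supRho h M - ((h 1 * ∫ x, x ∂μ : ℝ) : EReal)) :
    supRho (concaveEnv h) M ≤ supRho h M := by
  refine sSup_le ?_
  rintro _ ⟨μ, hμ, -, rfl⟩
  rw [rho_concaveEnv_eq hh (hM hμ),
    ← EReal.le_sub_iff_add_le (Or.inl (EReal.coe_ne_bot _)) (Or.inl (EReal.coe_ne_top _))]
  exact H μ hμ

/-! ### Part (i): closure under all concentrations -/

theorem supRho_eq_of_closedConc (hM : M ⊆ finiteMean) (hh : IsDistortion h) (hc : ClosedConc M) :
    supRho h M = supRho (concaveEnv h) M := by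
  refine le_antisymm (supRho_le_supRho_concaveEnv hM hh) (supRho_concaveEnv_le hM hh ?_)
  intro μ hμ
  have := (hM hμ).1
  set g := tilt (concaveEnv h)
  set I := ∫⁻ x, ENNReal.ofReal (g (μ.real (Ioi x)))
  set s := supRho h M - ((h 1 * ∫ x, x ∂μ : ℝ) : EReal)
  have step : ∀ ε : ℝ, 0 < ε → ε < 1 → ((ENNReal.ofReal (1 - ε) * I : ENNReal) : EReal) ≤ s := by
    intro ε hε hε1
    obtain ⟨J, hJ, hle, hmono, hlim⟩ := exists_approx hh hε hε1
    set G : ℕ → ℝ → ℝ := fun n x => chordal (J n) g (μ.real (Ioi x))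
    have Gpos : ∀ n x, 0 ≤ G n x := fun n x => chordal_nonneg (hJ n) (tilt_concaveEnv_nonneg hh) _
    have Gm : ∀ n, Measurable (G n) := fun n =>
      (measurable_chordal (J n) (measurable_tilt (isDistortion_concaveEnv hh))).comp
        (measurable_tail μ)
    have hle' : ∀ n x, (1 - ε) * G n x ≤ chordal (J n) (tilt h) (μ.real (Ioi x)) := fun n x =>
      hle n _ (tail_mem_Icc μ x)
    have pos' : ∀ n x, 0 ≤ (1 - ε) * G n x := fun n x => mul_nonneg (by linarith) (Gpos n x)
    have bound : ∀ n, ((ENNReal.ofReal (1 - ε) * ∫⁻ x, ENNReal.ofReal (G n x) : ENNReal) : EReal)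
        ≤ s := by
      intro n
      have z : ∀ x : ℝ, ENNReal.ofReal (-chordal (J n) (tilt h) (μ.real (Ioi x))) = 0 := fun x =>
        ENNReal.ofReal_of_nonpos (neg_nonpos.2 ((pos' n x).trans (hle' n x)))
      have := extInt_chordal_le_supRho hM hh (hJ n) (fun p hp ν hν => hc ν hν (levels p)
        ⟨((hJ n).levels_subset hp).trans Ioo_subset_Icc_self, ordConnected_Ioo⟩) hμ
        (by simp only [z]; simp)
      refine le_trans ?_ this
      refine le_trans (le_of_eq ?_) (extInt_mono (hle' n))
      rw [extInt_of_nonneg (pos' n)]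
      congr 1
      rw [← lintegral_const_mul _ (Gm n).ennreal_ofReal]
      refine lintegral_congr fun x => ?_
      rw [ENNReal.ofReal_mul (by linarith)]
    -- Monotone convergence for fixed $\varepsilon$; this also covers an infinite limit.
    have T : Filter.Tendsto (fun n => ∫⁻ x, ENNReal.ofReal (G n x)) Filter.atTop (nhds I) := by
      refine lintegral_tendsto_of_tendsto_of_monotone
        (fun n => (Gm n).ennreal_ofReal.aemeasurable) (ae_of_all _ fun x => ?_)
        (ae_of_all _ fun x => ?_)
      · exact fun m n hmn => ENNReal.ofReal_le_ofReal (hmono _ (tail_mem_Icc μ x) hmn)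
      · exact (ENNReal.continuous_ofReal.tendsto _).comp (hlim _ (tail_mem_Icc μ x))
    have T' := ENNReal.Tendsto.const_mul (a := ENNReal.ofReal (1 - ε)) T
      (Or.inr ENNReal.ofReal_ne_top)
    exact le_of_tendsto' ((continuous_coe_ennreal_ereal.tendsto _).comp T') bound
  -- Now $\varepsilon\to0$; the extra factor $1/2$ keeps $\varepsilon<1$ already for $n=0$.
  have T : Filter.Tendsto (fun n : ℕ => ENNReal.ofReal (1 - 1 / 2 * (1 / 2) ^ n) * I) Filter.atTop
      (nhds I) := by
    have t1 : Filter.Tendsto (fun n : ℕ => (1 - 1 / 2 * (1 / 2) ^ n : ℝ)) Filter.atTop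
        (nhds (1 - 1 / 2 * 0)) :=
      ((tendsto_pow_atTop_nhds_zero_of_lt_one (by norm_num)
        (by norm_num : (1 / 2 : ℝ) < 1)).const_mul _).const_sub _
    have t2 := (ENNReal.continuous_ofReal.tendsto _).comp t1
    have t3 := ENNReal.Tendsto.mul_const (b := I) t2 (Or.inl (by simp))
    simpa using t3
  refine le_of_tendsto' ((continuous_coe_ennreal_ereal.tendsto _).comp T) fun n => ?_
  have p1 : (1 / 2 : ℝ) ^ n ≤ 1 := pow_le_one₀ (by norm_num) (by norm_num)
  exact step _ (by positivity) (by linarith)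

/-! ### Part (ii): concentration within the gaps -/

/-- At the ends of a gap $\tilde h$ meets its envelope, so both have the same chord, and the
envelope is its own chord there. -/
lemma chordal_tilt_eq (hh : IsDistortion h) (hu : EqOn h (uscMod h) (Icc 0 1))
    (hcont : ∀ a b, IsGap h a b → ContinuousOn (concaveEnv h) (Icc a b)) {J : Finset (ℝ × ℝ)}
    (hJ : (J : Set (ℝ × ℝ)) ⊆ gaps h) {p : ℝ × ℝ} (hp : p ∈ J) {t : ℝ} (ht : t ∈ Ioo p.1 p.2) :
    chordal J (tilt h) t = tilt (concaveEnv h) t := by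
  rw [chordal_of_mem ((isFamily_gaps h).mono hJ) _ hp ht,
    ← chord_eq_on_gap hh hu (hJ hp) (hcont _ _ (hJ hp)) ht, chord, chord,
    (tilt_eq_at_endpoints hh hu (hJ hp)).1, (tilt_eq_at_endpoints hh hu (hJ hp)).2]

lemma finite_gaps (hfin : (gapIntervals h).Finite) : (gaps h).Finite := by
  rw [gapIntervals_eq] at hfin
  refine hfin.of_finite_image fun p hp q hq hpq => ?_
  have hlt := (isFamily_gaps h).lt p hp
  have hm : 1 - (p.1 + p.2) / 2 ∈ levels p := ⟨by linarith, by linarith⟩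
  exact (isFamily_gaps h).levels_disj hp hq hm (hpq ▸ hm)

theorem supRho_eq_of_closedConcWithin (hM : M ⊆ finiteMean) (hh : IsDistortion h)
    (hu : EqOn h (uscMod h) (Icc 0 1))
    (hcont : ∀ a b, IsGap h a b → ContinuousOn (concaveEnv h) (Icc a b))
    (hfin : (gapIntervals h).Finite ∨ ∀ μ ∈ M, rhoNeg h μ ≠ ⊤)
    (hc : ClosedConcWithin (gapIntervals h) M) : supRho h M = supRho (concaveEnv h) M := by
  refine le_antisymm (supRho_le_supRho_concaveEnv hM hh) (supRho_concaveEnv_le hM hh ?_)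
  intro μ hμ
  have := (hM hμ).1
  have F := isFamily_gaps h
  have hc' : ∀ p ∈ gaps h, ∀ ν ∈ M, conc (levels p) ν ∈ M := fun p hp ν hν =>
    hc ν hν _ (by rw [gapIntervals_eq]; exact mem_image_of_mem _ hp)
  set g := tilt (concaveEnv h)
  have gpos : ∀ t, 0 ≤ g t := tilt_concaveEnv_nonneg hh
  by_cases hf : (gaps h).Finite
  · have e : ∀ x : ℝ, chordal hf.toFinset (tilt h) (μ.real (Ioi x)) = g (μ.real (Ioi x)) := by
      intro x
      by_cases hx : ∃ p ∈ gaps h, μ.real (Ioi x) ∈ Ioo p.1 p.2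
      · obtain ⟨p, hp, hxp⟩ := hx
        exact chordal_tilt_eq hh hu hcont (by simp) (hf.mem_toFinset.2 hp) hxp
      · push Not at hx
        rw [chordal_of_notMem _ fun p hp => hx p (hf.mem_toFinset.1 hp)]
        exact tilt_eq_of_notMem_gaps hh hu (tail_mem_Icc μ x) hx
    have z : ∀ x : ℝ, ENNReal.ofReal (-g (μ.real (Ioi x))) = 0 := fun x =>
      ENNReal.ofReal_of_nonpos (neg_nonpos.2 (gpos _))
    have key := extInt_chordal_le_supRho hM hh (J := hf.toFinset) (by simpa using F)
      (fun p hp => hc' p (hf.mem_toFinset.1 hp)) hμ (by simp only [e, z]; simp)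
    simp only [e] at key
    rwa [extInt_of_nonneg fun x => gpos _] at key
  · have hneg : rhoNeg h μ ≠ ⊤ := by
      rcases hfin with h1 | h1
      · exact absurd (finite_gaps h1) hf
      · exact h1 μ hμ
    rw [rhoNeg_ne_top_iff (measurable_tilt hh) (hM hμ)] at hneg
    have hne : (gaps h).Nonempty := by
      by_contra h0; exact hf (by rw [not_nonempty_iff_eq_empty.1 h0]; exact finite_empty)
    obtain ⟨b, hb⟩ := F.countable.exists_eq_range hne
    -- Exhaustion of the gaps by finite subfamilies. The chordal functions increase from $\tilde h$
    -- to $g$, but need not be nonnegative before the limit.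
    set J : ℕ → Finset (ℝ × ℝ) := fun n => (Finset.range n).image b
    have Jsub : ∀ n, (J n : Set (ℝ × ℝ)) ⊆ gaps h := by
      intro n p hp
      obtain ⟨k, -, rfl⟩ := Finset.mem_image.1 hp
      rw [hb]; exact mem_range_self k
    have Jmono : Monotone J := fun m n hmn => Finset.image_subset_image (Finset.range_mono hmn)
    have FJ : ∀ n, IsFamily (J n : Set (ℝ × ℝ)) := fun n => F.mono (Jsub n)
    set f : ℕ → ℝ → ℝ := fun n x => chordal (J n) (tilt h) (μ.real (Ioi x)) with hfdef
    have fm : ∀ n, Measurable (f n) := fun n =>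
      (measurable_chordal (J n) (measurable_tilt hh)).comp (measurable_tail μ)
    have fge : ∀ n x, tilt h (μ.real (Ioi x)) ≤ f n x := by
      intro n x
      by_cases hx : ∃ p ∈ J n, μ.real (Ioi x) ∈ Ioo p.1 p.2
      · obtain ⟨p, hp, hxp⟩ := hx
        simp only [hfdef]
        rw [chordal_tilt_eq hh hu hcont (Jsub n) hp hxp]
        exact tilt_le_tilt_concaveEnv hh _
      · push Not at hx
        simp only [hfdef]; rw [chordal_of_notMem _ hx]
    have fmono : ∀ x, Monotone fun n => f n x := by
      intro x m n hmn
      by_cases hx : ∃ p ∈ J m, μ.real (Ioi x) ∈ Ioo p.1 p.2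
      · obtain ⟨p, hp, hxp⟩ := hx
        simp only [hfdef]
        rw [chordal_tilt_eq hh hu hcont (Jsub n) (Jmono hmn hp) hxp,
          chordal_tilt_eq hh hu hcont (Jsub m) hp hxp]
      · push Not at hx
        refine le_trans (le_of_eq ?_) (fge n x)
        exact chordal_of_notMem _ hx
    have flim : ∀ x, Filter.Tendsto (fun n => f n x) Filter.atTop (nhds (g (μ.real (Ioi x)))) := by
      intro x
      by_cases hx : ∃ p ∈ gaps h, μ.real (Ioi x) ∈ Ioo p.1 p.2
      · obtain ⟨p, hp, hxp⟩ := hx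
        obtain ⟨k, rfl⟩ : p ∈ range b := hb ▸ hp
        refine tendsto_const_nhds.congr' ?_
        filter_upwards [Filter.eventually_gt_atTop k] with n hn
        exact (chordal_tilt_eq hh hu hcont (Jsub n)
          (Finset.mem_image_of_mem b (Finset.mem_range.2 hn)) hxp).symm
      · push Not at hx
        refine tendsto_const_nhds.congr fun n => ?_
        simp only [hfdef]
        rw [chordal_of_notMem _ fun p hp => hx p (Jsub n hp)]
        exact (tilt_eq_of_notMem_gaps hh hu (tail_mem_Icc μ x) hx).symm
    have nle : ∀ n x, ENNReal.ofReal (-f n x) ≤ ENNReal.ofReal (-tilt h (μ.real (Ioi x))) :=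
      fun n x => ENNReal.ofReal_le_ofReal (neg_le_neg (fge n x))
    have bound : ∀ n, extInt (f n) volume ≤ supRho h M - ((h 1 * ∫ x, x ∂μ : ℝ) : EReal) :=
      fun n => extInt_chordal_le_supRho hM hh (FJ n) (fun p hp => hc' p (Jsub n hp)) hμ
        (ne_top_of_le_ne_top hneg (lintegral_mono (nle n)))
    have T1 : Filter.Tendsto (fun n => ∫⁻ x, ENNReal.ofReal (f n x)) Filter.atTop
        (nhds (∫⁻ x, ENNReal.ofReal (g (μ.real (Ioi x))))) := by
      refine lintegral_tendsto_of_tendsto_of_monotone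
        (fun n => (fm n).ennreal_ofReal.aemeasurable) (ae_of_all _ fun x => ?_)
        (ae_of_all _ fun x => ?_)
      · exact fun m n hmn => ENNReal.ofReal_le_ofReal (fmono x hmn)
      · exact (ENNReal.continuous_ofReal.tendsto _).comp (flim x)
    -- The negative parts are dominated by that of $\tilde h$; this is where a finite negative part
    -- is needed. Their limit is $0$, so the difference stays away from the point where `EReal`
    -- addition is discontinuous.
    have T2 : Filter.Tendsto (fun n => ∫⁻ x, ENNReal.ofReal (-f n x)) Filter.atTop
        (nhds (∫⁻ x : ℝ, 0)) := by
      refine tendsto_lintegral_of_dominated_convergence _ (fun n => (fm n).neg.ennreal_ofReal)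
        (fun n => ae_of_all _ (nle n)) hneg (ae_of_all _ fun x => ?_)
      have := (ENNReal.continuous_ofReal.tendsto _).comp (flim x).neg
      rwa [ENNReal.ofReal_of_nonpos (neg_nonpos.2 (gpos _))] at this
    rw [lintegral_zero] at T2
    have T1' := (continuous_coe_ennreal_ereal.tendsto _).comp T1
    have T2' := (continuous_neg.tendsto _).comp ((continuous_coe_ennreal_ereal.tendsto _).comp T2)
    have T := (EReal.continuousAt_add
      (p := (((∫⁻ x, ENNReal.ofReal (g (μ.real (Ioi x))) : ENNReal) : EReal), -((0 : ENNReal) : EReal))) (Or.inr (by simp)) (Or.inr (by simp))).tendsto.comp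
      (T1'.prodMk_nhds T2')
    simp only [EReal.coe_ennreal_zero, neg_zero, add_zero] at T
    exact le_of_tendsto' T fun n => bound n

/-! ### Part (iii): maximizers and concentration on all gaps -/

/-- Concentration on a family of intervals on which `g` is affine does not change the integral of
`g` along the tail function. -/
lemma lintegral_tail_concAll {μ : Measure ℝ} (hμ : μ ∈ finiteMean) {J : Set (ℝ × ℝ)}
    (hJ : IsFamily J) {g : ℝ → ℝ} (hgm : Measurable g) (hpos : ∀ t, 0 ≤ g t)
    (haff : ∀ p ∈ J, ∀ t ∈ Ioo p.1 p.2, chord g p t = g t) :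
    ∫⁻ x, ENNReal.ofReal (g ((concAll (levels '' J) μ).real (Ioi x))) =
      ∫⁻ x, ENNReal.ofReal (g (μ.real (Ioi x))) := by
  have := hμ.1
  have : Countable J := hJ.countable.to_subtype
  let E : J → Set ℝ := fun p => {x | μ.real (Ioi x) ∈ Ioo p.1.1 p.1.2}
  have mE : ∀ p, MeasurableSet (E p) := fun p => measurable_tail μ measurableSet_Ioo
  have hd : Pairwise (Function.onFun Disjoint E) := fun p q hpq =>
    disjoint_left.2 fun x h1 h2 => hpq (Subtype.ext (hJ.disj p p.2 q q.2 _ h1 h2))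
  have mW : MeasurableSet (⋃ p, E p) := MeasurableSet.iUnion mE
  rw [← lintegral_add_compl _ mW,
    ← lintegral_add_compl (fun x => ENNReal.ofReal (g (μ.real (Ioi x)))) mW]
  congr 1
  · rw [lintegral_iUnion mE hd, lintegral_iUnion mE hd]
    congr 1
    funext p
    have h0 := hJ.nonneg p p.2
    have hlt := hJ.lt p p.2
    have h1 := hJ.le_one p p.2
    have hS := isFamily_singleton h0 hlt h1
    have hS' : IsFamily (({p.1} : Finset (ℝ × ℝ)) : Set (ℝ × ℝ)) := by simpa using hS
    have hν := (conc_mem_finiteMean hμ h0 hlt h1).1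
    have := hν.1
    have eC : conc (levels p) μ = concAll (levels '' {p.1}) μ := by
      rw [conc_eq_concAll, image_singleton]
    -- Where the tail lies in `p`, the other intervals have no influence, so the claim reduces to a
    -- single interval. The chord identity then applies, and it involves only `E p`, since the
    -- integrand vanishes elsewhere.
    have e1 : ∫⁻ x in E p, ENNReal.ofReal (g ((concAll (levels '' J) μ).real (Ioi x))) =
        ∫⁻ x in E p, ENNReal.ofReal (g ((conc (levels p) μ).real (Ioi x))) := by
      refine setLIntegral_congr_fun (mE p) fun x hx => ?_
      rw [eC, tail_concAll_of_mem hμ hJ p.2 hx, tail_concAll_of_mem hμ hS rfl hx]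
    rw [e1]
    obtain ⟨hi, he⟩ := integrable_sub_chordal_conc hμ h0 hlt h1 g
    set f1 : ℝ → ℝ := (E p).indicator fun x => g ((conc (levels p) μ).real (Ioi x)) with hf1
    set f2 : ℝ → ℝ := (E p).indicator fun x => g (μ.real (Ioi x)) with hf2
    have hsub : (fun x => g ((conc (levels p) μ).real (Ioi x)) -
        chordal {p.1} g (μ.real (Ioi x))) = fun x => f1 x - f2 x := by
      funext x
      by_cases hx : x ∈ E p
      · rw [hf1, hf2, indicator_of_mem hx, indicator_of_mem hx,
          chordal_of_mem hS' g (Finset.mem_singleton_self _) hx, haff p p.2 _ hx]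
      · rw [hf1, hf2, indicator_of_notMem hx, indicator_of_notMem hx, eC,
          tail_concAll_of_notMem hμ hS (by rintro q rfl; exact hx),
          chordal_of_notMem g (fun q hq => by rw [Finset.mem_singleton.1 hq]; exact hx)]
        ring
    rw [hsub] at hi he
    have m1 : Measurable f1 := (hgm.comp (measurable_tail _)).indicator (mE p)
    have m2 : Measurable f2 := (hgm.comp (measurable_tail _)).indicator (mE p)
    have := extInt_eq_add m2 m1 hi
    rw [he, EReal.coe_zero, add_zero,
      extInt_of_nonneg fun x => indicator_nonneg (fun _ _ => hpos _) x,
      extInt_of_nonneg fun x => indicator_nonneg (fun _ _ => hpos _) x,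
      EReal.coe_ennreal_eq_coe_ennreal_iff] at this
    have ind : ∀ k : ℝ → ℝ, ∫⁻ x, ENNReal.ofReal ((E p).indicator k x) =
        ∫⁻ x in E p, ENNReal.ofReal (k x) := by
      intro k
      rw [← lintegral_indicator (mE p)]
      refine lintegral_congr fun x => ?_
      by_cases hx : x ∈ E p
      · rw [indicator_of_mem hx, indicator_of_mem hx]
      · rw [indicator_of_notMem hx, indicator_of_notMem hx, ENNReal.ofReal_zero]
    rwa [ind, ind] at this
  · refine setLIntegral_congr_fun mW.compl fun x hx => ?_
    rw [tail_concAll_of_notMem hμ hJ]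
    intro p hp hxp
    exact hx (mem_iUnion.2 ⟨⟨p, hp⟩, hxp⟩)

/-- A value of the concentrated tail function is an endpoint of some interval or an old value
outside all of them. -/
lemma tail_concAll_notMem {μ : Measure ℝ} (hμ : μ ∈ finiteMean) {J : Set (ℝ × ℝ)}
    (hJ : IsFamily J) (x : ℝ) {p : ℝ × ℝ} (hp : p ∈ J) :
    (concAll (levels '' J) μ).real (Ioi x) ∉ Ioo p.1 p.2 := by
  by_cases hx : ∃ q ∈ J, μ.real (Ioi x) ∈ Ioo q.1 q.2
  · obtain ⟨q, hq, hxq⟩ := hx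
    rw [tail_concAll_of_mem hμ hJ hq hxq]
    split_ifs
    · exact (hJ.endpoints_notMem hq hp).2
    · exact (hJ.endpoints_notMem hq hp).1
  · push Not at hx
    rw [tail_concAll_of_notMem hμ hJ hx]
    exact hx p hp

lemma rho_concAll_gapIntervals (hh : IsDistortion h) (hu : EqOn h (uscMod h) (Icc 0 1))
    (hcont : ∀ a b, IsGap h a b → ContinuousOn (concaveEnv h) (Icc a b)) {μ : Measure ℝ}
    (hμ : μ ∈ finiteMean) :
    RhoDefined h (concAll (gapIntervals h) μ) ∧
      rho h (concAll (gapIntervals h) μ) = rho (concaveEnv h) (concAll (gapIntervals h) μ) ∧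
      RhoDefined (concaveEnv h) (concAll (gapIntervals h) μ) ∧
      rho (concaveEnv h) (concAll (gapIntervals h) μ) = rho (concaveEnv h) μ := by
  have F := isFamily_gaps h
  have hm := measurable_tilt (isDistortion_concaveEnv hh)
  obtain ⟨hν, hmean⟩ := concAll_mem_finiteMean hμ F
  rw [gapIntervals_eq]
  have := hν.1
  set ν := concAll (levels '' gaps h) μ
  have e : ∀ x : ℝ, tilt h (ν.real (Ioi x)) = tilt (concaveEnv h) (ν.real (Ioi x)) := fun x =>
    tilt_eq_of_notMem_gaps hh hu (tail_mem_Icc ν x) fun p hp => tail_concAll_notMem hμ F x hp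
  have d := rhoNeg_concaveEnv_ne_top hh hν
  refine ⟨Or.inr ?_, ?_, Or.inr d, ?_⟩
  · rw [rhoNeg_ne_top_iff hm hν] at d
    rw [rhoNeg_ne_top_iff (measurable_tilt hh) hν]
    simpa only [e] using d
  · rw [rho_eq (measurable_tilt hh) hν, rho_eq hm hν, concaveEnv_one hh]
    simp only [e]
  · rw [rho_concaveEnv_eq hh hν, rho_concaveEnv_eq hh hμ, hmean,
      lintegral_tail_concAll hμ F hm (tilt_concaveEnv_nonneg hh)
        fun p hp t ht => chord_eq_on_gap hh hu hp (hcont _ _ hp) ht]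

end Comparison

end DistortionRisk

end

open DistortionRisk in
theorem theorem1 {Ω : Type*} [MeasurableSpace Ω] (P : MeasureTheory.Measure Ω)
    [MeasureTheory.IsProbabilityMeasure P] (hP : Atomless P)
    (M : Set (MeasureTheory.Measure ℝ)) (hM : M ⊆ finiteMean)
    (h : ℝ → ℝ) (hh : IsDistortion h) :
    -- (i)
    (ClosedConc M → supRho h M = supRho (concaveEnv h) M) ∧
    -- (ii)
    (Set.EqOn h (uscMod h) (Set.Icc 0 1) →
      (∀ a b, IsGap h a b → ContinuousOn (concaveEnv h) (Set.Icc a b)) →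
      ((gapIntervals h).Finite ∨ ∀ μ ∈ M, rhoNeg h μ ≠ ⊤) →
      ClosedConcWithin (gapIntervals h) M →
      supRho h M = supRho (concaveEnv h) M) ∧
    -- (iii)
    (Set.EqOn h (uscMod h) (Set.Icc 0 1) →
      (∀ a b, IsGap h a b → ContinuousOn (concaveEnv h) (Set.Icc a b)) →
      ClosedCondExp P M →
      ∀ μ ∈ M, rho (concaveEnv h) μ = supRho (concaveEnv h) M →
        concAll (gapIntervals h) μ ∈ M ∧
        RhoDefined h (concAll (gapIntervals h) μ) ∧
        rho h (concAll (gapIntervals h) μ) = supRho h M ∧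
        RhoDefined (concaveEnv h) (concAll (gapIntervals h) μ) ∧
        rho (concaveEnv h) (concAll (gapIntervals h) μ) = supRho (concaveEnv h) M) := by
  refine ⟨fun hc => supRho_eq_of_closedConc hM hh hc,
    fun hu hcont hfin hc => supRho_eq_of_closedConcWithin hM hh hu hcont hfin hc,
    fun hu hcont hc μ hμ hmax => ?_⟩
  obtain ⟨d1, e1, d2, e2⟩ := rho_concAll_gapIntervals hh hu hcont (hM hμ)
  have hmem : concAll (gapIntervals h) μ ∈ M := by
    rw [gapIntervals_eq]
    exact concAll_mem_of_closedCondExp hP hc (hM hμ) hμ (isFamily_gaps h)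
  have e3 := e2.trans hmax
  -- The value of $\rho_h$ at the concentration equals the supremum for the envelope, which
  -- dominates the supremum for $h$; closure under single concentrations is not used.
  refine ⟨hmem, d1, le_antisymm (rho_le_supRho hmem d1) ?_, d2, e3⟩
  rw [e1, e3]
  exact supRho_le_supRho_concaveEnv hM hh
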